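/- Let $n$ and $d$ be integers with $1\le d\le n-1$. Let $\mathsf{Path}_n$ be the path graph with vertices $v_1,\ldots,v_n$ (where $v_i$ and $v_{i+1}$ are adjacent for $1\le i\le n-1$), and let $\Lambda_{\mathsf{Path}_n}$ be its set of labelings, i.e., bijections $\sigma\colon\{v_1,\ldots,v_n\}\to\mathbb Z/n\mathbb Z$. For $i\in\mathbb Z/n\mathbb Z$, let $\tau_i\colon\Lambda_{\mathsf{Path}_n}\to\Lambda_{\mathsf{Path}_n}$ be the toggle operator that swaps the labels $i$ and $i+1$ if they are assigned to nonadjacent vertices, i.e., $\tau_i(\sigma)=(i\;\,i+1)\circ\sigma$ if $\sigma^{-1}(i)$ and $\sigma^{-1}(i+1)$ are not adjacent, and $\tau_i(\sigma)=\sigma$ otherwise. Let $\mathrm{cyc}$ be the cyclic shift $(\mathrm{cyc}(\sigma))(v)=\sigma(v)+1$. Define \[\Phi_{n,d}=\mathrm{cyc}^d(\tau_{n-d}\tau_{n-d+1}\cdots\tau_{n-1})\cdots(\tau_2\tau_3\cdots\tau_{d+1})(\tau_1\tau_2\cdots\tau_d)\colon\Lambda_{\mathsf{Path}_n}\to\Lambda_{\mathsf{Path}_n},\]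 where concatenation of operators is composition (the rightmost operator acts first). Let $\mathsf{Comp}_d(n)$ be the set of compositions of $n$ with $d$ parts (i.e., $d$-tuples of positive integers that sum to $n$), and let $\mathrm{Rot}_{n,d}\colon\mathsf{Comp}_d(n)\to\mathsf{Comp}_d(n)$ be given by $\mathrm{Rot}_{n,d}(a_1,a_2,\ldots,a_d)=(a_2,\ldots,a_d,a_1)$. For an invertible map $f$ from a finite set to itself, let $\mathrm{Orb}_f$ denote the set of orbits of $f$. Then there is a map $\Omega\colon\mathrm{Orb}_{\Phi_{n,d}}\to\mathrm{Orb}_{\mathrm{Rot}_{n,d}}$ such that $|\Omega(\mathcal O)|=\frac{d}{n}|\mathcal O|$ for every $\mathcal O\in\mathrm{Orb}_{\Phi_{n,d}}$ and $|\Omega^{-1}(\widehat{\mathcal O})|=d!(n-d)!$ for every $\widehat{\mathcal O}\in\mathrm{Orb}_{\mathrm{Rot}_{n,d}}$. -/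

import Mathlib

open scoped Nat

namespace PermutoricPromotion

/-- A labeling with labels in `ℤ/nℤ` of a graph with vertex set `V`: a bijection
`V → ℤ/nℤ`. -/
abbrev Labeling (V : Type*) (n : ℕ) : Type _ := V ≃ ZMod n

section Graph

variable {V : Type*} (G : SimpleGraph V) [DecidableRel G.Adj] {n : ℕ}

/-- The toggle `τ_i` as a map: swap the labels `i` and `i + 1` if they sit on non-adjacent
vertices, and do nothing otherwise. -/
def toggleFun (i : ZMod n) (σ : Labeling V n) : Labeling V n :=
  if G.Adj (σ.symm i) (σ.symm (i + 1)) then σ else σ.trans (Equiv.swap i (i + 1))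

theorem toggleFun_involutive (i : ZMod n) :
    Function.Involutive (toggleFun G i : Labeling V n → Labeling V n) := by
  intro σ
  unfold toggleFun
  by_cases h : G.Adj (σ.symm i) (σ.symm (i + 1))
  · simp [h]
  · have h' : ¬ G.Adj (σ.symm (i + 1)) (σ.symm i) := fun hh => h hh.symm
    simp only [h, if_false, Equiv.symm_trans_apply, Equiv.symm_swap, Equiv.swap_apply_left,
      Equiv.swap_apply_right, h']
    ext v
    simp

/-- The toggle operator `τ_i`, as a permutation of the set of labelings. -/
def toggle (i : ZMod n) : Equiv.Perm (Labeling V n) :=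
  (toggleFun_involutive G i).toPerm _

end Graph

/-- The cyclic shift operator: `(cyc σ)(v) = σ(v) + 1`. -/
def cyc (V : Type*) (n : ℕ) : Equiv.Perm (Labeling V n) where
  toFun σ := σ.trans (Equiv.addRight 1)
  invFun σ := σ.trans (Equiv.addRight 1).symm
  left_inv σ := by ext v; simp
  right_inv σ := by ext v; simp

instance pathGraphDecidableAdj (n : ℕ) : DecidableRel (SimpleGraph.pathGraph n).Adj :=
  fun _ _ => decidable_of_iff' _ SimpleGraph.pathGraph_adj

/-- The word `τ_i τ_{i+1} ⋯ τ_{i+d-1}` acting on the labelings of the path with `n` vertices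
(a product of permutations is composition, so the rightmost factor acts first). -/
def toggleRun (n d i : ℕ) : Equiv.Perm (Labeling (Fin n) n) :=
  ((List.range d).map fun j : ℕ => toggle (SimpleGraph.pathGraph n) ((i + j : ℕ) : ZMod n)).prod

/-- `Φ_{n,d} = cyc^d (τ_{n-d} ⋯ τ_{n-1}) ⋯ (τ_2 ⋯ τ_{d+1}) (τ_1 ⋯ τ_d)`: the list is the
sequence of the runs starting at `n - d, …, 2, 1`, in this order. -/
def Phi (n d : ℕ) : Equiv.Perm (Labeling (Fin n) n) :=
  cyc (Fin n) n ^ d *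
    ((List.range (n - d)).reverse.map fun i : ℕ => toggleRun n d (i + 1)).prod

/-- The set of compositions of `n` with `d` parts: `d`-tuples of positive integers with
sum `n`. -/
def Comp (n d : ℕ) : Type :=
  {a : Fin d → ℕ // (∀ i, 0 < a i) ∧ ∑ i, a i = n}

/-- The rotation `(a_1, a_2, …, a_d) ↦ (a_2, …, a_d, a_1)`; `finRotate d` sends each index to
the next one, cyclically. -/
def Rot (n d : ℕ) : Equiv.Perm (Comp n d) where
  toFun a := ⟨fun i => a.1 (finRotate d i), fun i => a.2.1 _, by
    rw [Equiv.sum_comp (finRotate d) a.1]; exact a.2.2⟩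
  invFun a := ⟨fun i => a.1 ((finRotate d).symm i), fun i => a.2.1 _, by
    rw [Equiv.sum_comp (finRotate d).symm a.1]; exact a.2.2⟩
  left_inv a := Subtype.ext <| funext fun i => congrArg a.1 ((finRotate d).apply_symm_apply i)
  right_inv a := Subtype.ext <| funext fun i => congrArg a.1 ((finRotate d).symm_apply_apply i)

/-- The set of orbits (as subsets of `X`) of an invertible map `f : X → X`; here
`f.SameCycle x y` means `y = f ^ k x` for some integer `k`. -/
def Orb {X : Type*} (f : Equiv.Perm X) : Set (Set X) :=
  Set.range fun x : X => {y : X | f.SameCycle x y}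

end PermutoricPromotion

/-!
Let `m = n - d`. Follow the labels as `n` lines: the `d` lines starting at the labels `1, …, d`
are called coins and the `m` lines starting at `d + 1, …, n` are called vacancies. In `Φ`, the
toggles make each coin meet each vacancy exactly once, after which `cyc ^ d` brings every line back
to the label where it started. When a coin and a vacancy meet, the vertices carrying them are
exchanged if these vertices are adjacent on the path, and kept otherwise
(`IsLabeledBy.toggle`). Hence the left-to-right order of the coins on the path never changes, and
neither does that of the vacancies. A labeling is the same as these two orders (`d! * m!` choices)
together with the set of the positions of the coins, that is, a word with `d` coins and `m`
vacancies (`ofWord_bijective`), and `Φ` acts on the word alone (`IsLabeledBy.phi`).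

For fixed orders, the action on words is the product, in an order depending on the two orders, of
the `d * m` operators `exch i j` exchanging the `i`-th coin and the `j`-th vacancy if they are
neighbours. These operators commute unless their indices are neighbours in the grid
(`exch_comm`), so the lemma that all Coxeter elements of a path are conjugate
(`isConj_prod_descProd`), applied to the columns and then to the rows, makes the product
conjugate to the one in the standard order. Regrouped by antidiagonals, the latter becomes
the product of the exchanges of the positions `k` and `k + 1`, which is the rotation of words
(`isConj_prod_wordExch_wordRot`). Thus `Φ` is conjugate to `d! * m!` copies of the
rotation of words (`exists_equiv_phi`).

Finally, words are the quotient of the set of pairs of a composition and a base point in `ℤ/nℤ`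
by the moves of the base point to the next coin, compositions are its quotient by the shifts of the
base point, and these two moves commute. So the orbits of words and of compositions under rotation
correspond to each other, and comparing fibers of size `d` and `n` gives the ratio of their sizes
(`exists_equiv_orb_wordRot_rot`).
-/

open scoped Nat

namespace PermutoricPromotion

/-! ### Products of operators in different orders -/

/-- The descending product `f (k - 1) * ⋯ * f 1 * f 0`. -/
def descProd {G : Type*} [Monoid G] (f : ℕ → G) : ℕ → G
  | 0 => 1
  | k + 1 => f k * descProd f k

theorem commute_descProd {G : Type*} [Monoid G] {x : G} {f : ℕ → G} {k : ℕ}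
    (h : ∀ i < k, Commute x (f i)) : Commute x (descProd f k) := by
  induction k with
  | zero => exact Commute.one_right x
  | succ k ih => exact (h k k.lt_succ_self).mul_right (ih fun i hi => h i (hi.trans k.lt_succ_self))

theorem descProd_congr {G : Type*} [Monoid G] {f g : ℕ → G} {k : ℕ}
    (h : ∀ i < k, f i = g i) : descProd f k = descProd g k := by
  induction k with
  | zero => rfl
  | succ k ih =>
    rw [descProd, descProd, h k k.lt_succ_self, ih fun i hi => h i (hi.trans k.lt_succ_self)]

/-- The extra factor `e` absorbs the factors `g j` with large `j` one after the other in the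
induction. -/
theorem isConj_mul_prod_descProd {G : Type*} [Group G] {g : ℕ → G}
    (hg : ∀ i j, i + 2 ≤ j → Commute (g i) (g j)) (k : ℕ) :
    ∀ (e : G) (l : List ℕ), (∀ j, j + 1 < k → Commute e (g j)) → l.Perm (List.range k) →
      IsConj (e * (l.map g).prod) (e * descProd g k) := by
  induction k with
  | zero =>
    intro e l _ hl
    rw [List.range_zero, List.perm_nil] at hl
    subst hl
    exact IsConj.refl _
  | succ k ih =>
    intro e l he hl
    obtain ⟨l₁, l₂, rfl⟩ := List.append_of_mem (hl.mem_iff.2 (by simp : k ∈ List.range (k + 1)))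
    have hp : (l₂ ++ l₁).Perm (List.range k) := by
      rw [List.range_succ] at hl
      have h1 : (k :: (l₂ ++ l₁)).Perm (k :: List.range k) :=
        (((List.perm_append_comm (l₁ := l₁) (l₂ := k :: l₂)).symm.trans hl).trans
          (List.perm_append_singleton k (List.range k)))
      exact h1.cons_inv
    have hlt : ∀ j ∈ l₁, j < k := fun j hj =>
      List.mem_range.1 (hp.mem_iff.1 (List.mem_append_right _ hj))
    have hc : Commute e (l₁.map g).prod := by
      refine Commute.list_prod_right _ _ ?_
      intro x hx
      obtain ⟨j, hj, rfl⟩ := List.mem_map.1 hx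
      exact he j (by have := hlt j hj; omega)
    have h := ih (e * g k) (l₂ ++ l₁) (fun j hj =>
      (he j (by omega)).mul_left (hg j k (by omega)).symm) hp
    rw [descProd, ← mul_assoc]
    refine IsConj.trans ?_ h
    refine isConj_iff.2 ⟨((l₁.map g).prod)⁻¹, ?_⟩
    have hc' : e * (l₁.map g).prod = (l₁.map g).prod * e := hc
    simp only [List.map_append, List.map_cons, List.prod_append, List.prod_cons, inv_inv]
    rw [← mul_assoc e, hc']
    group

/-- Two Coxeter elements of a path are conjugate: if `g i` and `g j` commute whenever `i` and `j`
are not consecutive, then the product of `g 0, …, g (k - 1)` in any order is conjugate to the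
descending one. -/
theorem isConj_prod_descProd {G : Type*} [Group G] {g : ℕ → G}
    (hg : ∀ i j, i + 2 ≤ j → Commute (g i) (g j)) {k : ℕ} {l : List ℕ}
    (hl : l.Perm (List.range k)) : IsConj (l.map g).prod (descProd g k) := by
  simpa using isConj_mul_prod_descProd hg k 1 l (fun j _ => Commute.one_left _) hl

theorem descProd_mul {G : Type*} [Monoid G] {f g : ℕ → G} {k : ℕ}
    (h : ∀ i j, i < j → j < k → Commute (f i) (g j)) :
    descProd (fun i => f i * g i) k = descProd f k * descProd g k := by
  induction k with
  | zero => simp [descProd]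
  | succ k ih =>
    have hc : Commute (g k) (descProd f k) :=
      commute_descProd fun i hi => (h i k hi k.lt_succ_self).symm
    rw [descProd, descProd, descProd, ih fun i j hij hj => h i j hij (hj.trans k.lt_succ_self)]
    simp only [mul_assoc]
    rw [← mul_assoc (g k), hc.eq, mul_assoc]

/-- A noncommutative exchange of two products: only the pairs of factors whose order changes have
to commute. -/
theorem descProd_list_prod_comm {G : Type*} [Monoid G] {f : ℕ → ℕ → G} {k : ℕ} {l : List ℕ}
    (h : l.Pairwise fun r r' => ∀ i j, i < j → j < k → Commute (f r i) (f r' j)) :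
    descProd (fun i => (l.map fun r => f r i).prod) k =
      (l.map fun r => descProd (f r) k).prod := by
  induction l with
  | nil =>
    simp only [List.map_nil, List.prod_nil]
    induction k with
    | zero => rfl
    | succ k ih => rw [descProd, ih List.Pairwise.nil, one_mul]
  | cons r l ih =>
    rw [List.pairwise_cons] at h
    simp only [List.map_cons, List.prod_cons]
    rw [descProd_mul, ih h.2]
    intro i j hij hj
    refine Commute.list_prod_right _ _ ?_
    intro x hx
    obtain ⟨r', hr', rfl⟩ := List.mem_map.1 hx
    exact h.1 r' hr' i j hij hj

theorem descProd_eq_prod {G : Type*} [Monoid G] (f : ℕ → G) (k : ℕ) :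
    descProd f k = ((List.range k).reverse.map f).prod := by
  induction k with
  | zero => rfl
  | succ k ih => simp [descProd, ih, List.range_succ]

theorem descProd_one {G : Type*} [Monoid G] (k : ℕ) : descProd (fun _ => (1 : G)) k = 1 := by
  induction k with
  | zero => rfl
  | succ k ih => rw [descProd, ih, one_mul]

theorem descProd_add {G : Type*} [Monoid G] (f : ℕ → G) (a b : ℕ) :
    descProd f (a + b) = descProd (fun i => f (a + i)) b * descProd f a := by
  induction b with
  | zero => simp [descProd]
  | succ b ih => rw [← add_assoc, descProd, descProd, ih, mul_assoc]

/-! ### Words and exchange operators -/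

/-- The permutation of sets of naturals induced by exchanging the positions `k` and `k + 1`. -/
def adjSwap (k : ℕ) : Equiv.Perm (Finset ℕ) := (Equiv.swap k (k + 1)).finsetCongr

theorem mem_adjSwap {k x : ℕ} {S : Finset ℕ} :
    x ∈ adjSwap k S ↔ Equiv.swap k (k + 1) x ∈ S := by
  simp [adjSwap, Finset.mem_map_equiv]

theorem adjSwap_adjSwap (k : ℕ) (S : Finset ℕ) : adjSwap k (adjSwap k S) = S := by
  ext x
  simp [mem_adjSwap]

theorem adjSwap_comm {k l : ℕ} (h : k + 2 ≤ l) (S : Finset ℕ) :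
    adjSwap k (adjSwap l S) = adjSwap l (adjSwap k S) := by
  ext x
  simp only [mem_adjSwap]
  have : Equiv.swap l (l + 1) (Equiv.swap k (k + 1) x) =
      Equiv.swap k (k + 1) (Equiv.swap l (l + 1) x) := by
    simp only [Equiv.swap_apply_def]
    split_ifs <;> omega
  rw [this]

theorem adjSwap_eq_self {k : ℕ} {S : Finset ℕ} (h : k ∈ S ↔ k + 1 ∈ S) : adjSwap k S = S := by
  ext x
  rw [mem_adjSwap, Equiv.swap_apply_def]
  split_ifs with h1 h2
  · rw [h1, h]
  · rw [h2, h]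
  · rfl

theorem adjSwap_mem_powersetCard {n d k : ℕ} (hk : k + 1 < n) {S : Finset ℕ} :
    adjSwap k S ∈ Finset.powersetCard d (Finset.range n) ↔
      S ∈ Finset.powersetCard d (Finset.range n) := by
  have key : ∀ T : Finset ℕ, T ∈ Finset.powersetCard d (Finset.range n) →
      adjSwap k T ∈ Finset.powersetCard d (Finset.range n) := by
    intro T hT
    rw [Finset.mem_powersetCard] at hT ⊢
    refine ⟨fun x hx => ?_, by simp [adjSwap, hT.2]⟩
    have := Finset.mem_range.1 (hT.1 (mem_adjSwap.1 hx))
    rw [Equiv.swap_apply_def] at this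
    rw [Finset.mem_range]
    split_ifs at this <;> omega
  exact ⟨fun h => by simpa [adjSwap_adjSwap] using key _ h, key S⟩

/-- The number of elements of `S` below `k`. -/
def rank (S : Finset ℕ) (k : ℕ) : ℕ := Nat.count (· ∈ S) k

theorem rank_succ (S : Finset ℕ) (k : ℕ) : rank S (k + 1) = rank S k + if k ∈ S then 1 else 0 :=
  Nat.count_succ _ _

theorem rank_le (S : Finset ℕ) (k : ℕ) : rank S k ≤ k := Nat.count_le _

theorem rank_adjSwap {k j : ℕ} (h : j ≠ k + 1) (S : Finset ℕ) :
    rank (adjSwap k S) j = rank S j := by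
  simp only [rank, Nat.count_eq_card_filter_range]
  have : (Finset.range j).filter (· ∈ adjSwap k S) =
      ((Finset.range j).filter (· ∈ S)).map (Equiv.swap k (k + 1)).toEmbedding := by
    ext x
    simp only [Finset.mem_filter, Finset.mem_range, mem_adjSwap, Finset.mem_map_equiv,
      Equiv.symm_swap]
    have : x < j ↔ Equiv.swap k (k + 1) x < j := by
      rw [Equiv.swap_apply_def]
      split_ifs <;> omega
    rw [this]
  rw [this, Finset.card_map]

/-- Read a set `S` of naturals as a word whose letters are coins (the elements of `S`) and
vacancies. The operator exchanges the coin numbered `i` and the vacancy numbered `j`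
(counting from `0`, left to right) if they occupy consecutive positions, which are then
`i + j` and `i + j + 1`. Exchanging two equal letters does not change the word, so the condition
only has to say that exactly `i` coins precede the position `i + j`. -/
def exch (i j : ℕ) : Equiv.Perm (Finset ℕ) :=
  Function.Involutive.toPerm
    (fun S => if rank S (i + j) = i then adjSwap (i + j) S else S) (by
      intro S
      by_cases h : rank S (i + j) = i
      · simp [h, rank_adjSwap, adjSwap_adjSwap]
      · simp [h])

theorem exch_apply (i j : ℕ) (S : Finset ℕ) :
    exch i j S = if rank S (i + j) = i then adjSwap (i + j) S else S := rfl

theorem exch_mem_powersetCard {n d i j : ℕ} (h : i + j + 1 < n) {S : Finset ℕ} :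
    exch i j S ∈ Finset.powersetCard d (Finset.range n) ↔
      S ∈ Finset.powersetCard d (Finset.range n) := by
  rw [exch_apply]
  split_ifs
  · exact adjSwap_mem_powersetCard h
  · rfl

theorem rank_exch {i j k : ℕ} (h : k ≠ i + j + 1) (S : Finset ℕ) :
    rank (exch i j S) k = rank S k := by
  rw [exch_apply]
  split_ifs
  · exact rank_adjSwap h S
  · rfl

theorem exch_comm_of_add_two_le {i j i' j' : ℕ} (h : i + j + 2 ≤ i' + j') :
    Commute (exch i j) (exch i' j') := by
  ext1 S
  simp only [Equiv.Perm.mul_apply]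
  rw [exch_apply i j, exch_apply i' j' (exch i j S), rank_exch (by omega), rank_exch (by omega)]
  simp only [exch_apply]
  split_ifs
  · exact adjSwap_comm h S
  · rfl
  · rfl
  · rfl

theorem exch_comm_of_add_eq {i j i' j' : ℕ} (h : i + j = i' + j') :
    Commute (exch i j) (exch i' j') := by
  ext1 S
  simp only [Equiv.Perm.mul_apply]
  rw [exch_apply i j, exch_apply i' j' (exch i j S), rank_exch (by omega), rank_exch (by omega)]
  simp only [exch_apply, h]
  split_ifs <;> rfl

theorem exch_comm_of_add_one {i j i' j' : ℕ} (h : i' + j' = i + j + 1) (h0 : i' ≠ i)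
    (h1 : i' ≠ i + 1) : Commute (exch i j) (exch i' j') := by
  have key : ∀ S, rank S (i + j) = i → rank S (i' + j') ≠ i' := by
    intro S hS
    rw [h, rank_succ, hS]
    split_ifs <;> omega
  ext1 S
  simp only [Equiv.Perm.mul_apply]
  by_cases hS : rank S (i + j) = i
  · have h2 : exch i' j' S = S := by rw [exch_apply, if_neg (key S hS)]
    have h3 : exch i' j' (exch i j S) = exch i j S := by
      rw [exch_apply i' j', if_neg (key _ (by rw [rank_exch (by omega), hS]))]
    rw [h2, h3]
  · have h2 : exch i j S = S := by rw [exch_apply, if_neg hS]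
    have h3 : exch i j (exch i' j' S) = exch i' j' S := by
      rw [exch_apply i j, if_neg (by rwa [rank_exch (by omega)])]
    rw [h2, h3]

/-- Exchange operators commute unless their index pairs are neighbours in the grid `ℕ × ℕ`. -/
theorem exch_comm {i j i' j' : ℕ}
    (h : i + 2 ≤ i' ∨ j + 2 ≤ j' ∨ (i ≠ i' ∧ j ≠ j')) : Commute (exch i j) (exch i' j') := by
  rcases lt_trichotomy (i + j) (i' + j') with h1 | h1 | h1
  · by_cases h2 : i + j + 2 ≤ i' + j'
    · exact exch_comm_of_add_two_le h2
    · exact exch_comm_of_add_one (by omega) (by omega) (by omega)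
  · exact exch_comm_of_add_eq h1
  · by_cases h2 : i' + j' + 2 ≤ i + j
    · exact (exch_comm_of_add_two_le h2).symm
    · exact (exch_comm_of_add_one (by omega) (by omega) (by omega)).symm

/-- The words with `n` letters, `d` of which are coins, encoded as the set of positions of the
coins. -/
abbrev Word (n d : ℕ) : Type := {S : Finset ℕ // S ∈ Finset.powersetCard d (Finset.range n)}

/-- The exchange operator on words of length `n`; it is trivial if its positions do not lie
in the word. -/
def wordExch (n d i j : ℕ) : Equiv.Perm (Word n d) :=
  if h : i + j + 1 < n then (exch i j).subtypePerm fun _ => exch_mem_powersetCard h else 1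

/-- The exchange of the letters at positions `k` and `k + 1` of a word of length `n`. -/
def wordSwap (n d k : ℕ) : Equiv.Perm (Word n d) :=
  if h : k + 1 < n then (adjSwap k).subtypePerm fun _ => adjSwap_mem_powersetCard h else 1

theorem coe_wordExch {n d i j : ℕ} (h : i + j + 1 < n) (S : Word n d) :
    (wordExch n d i j S : Finset ℕ) = exch i j S := by
  simp [wordExch, h]

theorem coe_wordSwap {n d k : ℕ} (h : k + 1 < n) (S : Word n d) :
    (wordSwap n d k S : Finset ℕ) = adjSwap k S := by
  simp [wordSwap, h]

theorem wordExch_comm {n d i j i' j' : ℕ}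
    (h : i + 2 ≤ i' ∨ j + 2 ≤ j' ∨ (i ≠ i' ∧ j ≠ j')) :
    Commute (wordExch n d i j) (wordExch n d i' j') := by
  by_cases h1 : i + j + 1 < n
  · by_cases h2 : i' + j' + 1 < n
    · ext1 S
      apply Subtype.ext
      simp only [Equiv.Perm.mul_apply, coe_wordExch h1, coe_wordExch h2]
      exact congrArg (fun f : Equiv.Perm (Finset ℕ) => f S) (exch_comm h).eq
    · rw [wordExch, wordExch, dif_neg h2]
      exact Commute.one_right _
  · rw [wordExch, dif_neg h1]
    exact Commute.one_left _

/-- The rotation of words of length `n` by one step to the left, as the bubbling of the first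
letter to the last position. -/
def wordRot (n d : ℕ) : Equiv.Perm (Word n d) := descProd (wordSwap n d) (n - 1)

/-- Multiplying by `wordSwap n d 0, …, wordSwap n d (k - 1)` moves the first letter to position
`k`. -/
theorem coe_descProd_wordSwap {n d k : ℕ} (hk : k < n) (S : Word n d) :
    (descProd (wordSwap n d) k S : Finset ℕ) =
      (S : Finset ℕ).image fun x => if x = 0 then k else if x ≤ k then x - 1 else x := by
  induction k with
  | zero =>
    have : (fun x : ℕ => if x = 0 then 0 else if x ≤ 0 then x - 1 else x) = id := by
      funext x
      split_ifs <;> simp_all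
    rw [this, Finset.image_id]
    rfl
  | succ k ih =>
    rw [descProd, Equiv.Perm.mul_apply, coe_wordSwap hk, ih (by omega), adjSwap,
      Equiv.finsetCongr_apply, Finset.map_eq_image, Finset.image_image]
    congr 1
    funext x
    simp only [Function.comp_apply, Equiv.coe_toEmbedding, Equiv.swap_apply_def]
    split_ifs <;> omega

theorem coe_wordRot {n d : ℕ} (hn : 0 < n) (S : Word n d) :
    (wordRot n d S : Finset ℕ) =
      (S : Finset ℕ).image fun x => if x = 0 then n - 1 else x - 1 := by
  rw [wordRot, coe_descProd_wordSwap (by omega)]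
  refine Finset.image_congr fun x hx => ?_
  have := Finset.mem_range.1 ((Finset.mem_powersetCard.1 S.2).1 hx)
  split_ifs <;> omega

theorem rank_word_le {n d : ℕ} (S : Word n d) (k : ℕ) : rank S k ≤ d := by
  refine le_trans ?_ (Finset.mem_powersetCard.1 S.2).2.le
  rw [rank, Nat.count_eq_card_filter_range]
  exact Finset.card_le_card fun x hx => (Finset.mem_filter.1 hx).2

theorem rank_length {n d : ℕ} (S : Word n d) : rank S n = d := by
  obtain ⟨h1, h2⟩ := Finset.mem_powersetCard.1 S.2
  rw [rank, Nat.count_eq_card_filter_range]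
  refine Eq.trans (congrArg _ ?_) h2
  ext x
  simp only [Finset.mem_filter, and_iff_right_iff_imp]
  exact fun hx => h1 hx

theorem rank_add_le (S : Finset ℕ) (k l : ℕ) : rank S (k + l) ≤ rank S k + l := by
  rw [rank, Nat.count_add]
  exact Nat.add_le_add_left (Nat.count_le _) _

/-- The exchange operators with `i + j = k`, together, exchange the letters at positions `k` and
`k + 1`: only the one with `i` the number of coins before position `k` acts. -/
theorem descProd_wordExch_antidiagonal {d m k : ℕ} (hk : k + 1 < d + m) :
    descProd (fun r => if r ≤ k ∧ k < r + m then wordExch (d + m) d r (k - r) else 1) d =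
      wordSwap (d + m) d k := by
  ext1 S
  apply Subtype.ext
  have key : ∀ a, (descProd (fun r => if r ≤ k ∧ k < r + m then wordExch (d + m) d r (k - r)
      else 1) a S : Finset ℕ) =
      if rank S k < a ∧ k < rank S k + m then adjSwap k S else S := by
    intro a
    induction a with
    | zero => simp [descProd]
    | succ a ih =>
      rw [descProd, Equiv.Perm.mul_apply]
      set T := descProd (fun r => if r ≤ k ∧ k < r + m then wordExch (d + m) d r (k - r)
        else 1) a S with hT
      have hrT : rank T k = rank S k := by
        rw [ih]
        split_ifs
        · exact rank_adjSwap (by omega) _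
        · rfl
      by_cases ha : a ≤ k ∧ k < a + m
      · rw [if_pos ha, coe_wordExch (by omega), exch_apply, show a + (k - a) = k by omega, hrT, ih]
        by_cases h1 : rank S k = a
        · rw [if_pos h1, if_neg (by omega), if_pos (by omega)]
        · rw [if_neg h1]
          refine if_congr ?_ rfl rfl
          omega
      · rw [if_neg ha, Equiv.Perm.one_apply, ih]
        refine if_congr ?_ rfl rfl
        have := rank_le (S : Finset ℕ) k
        constructor
        · intro h; omega
        · intro h
          refine ⟨?_, h.2⟩
          by_contra h'
          have : rank S k = a := by omega
          omega
  rw [key, coe_wordSwap hk]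
  split_ifs with h
  · rfl
  · -- all coins, or all vacancies, come before position `k`, so its two letters are equal
    symm
    apply adjSwap_eq_self
    have e : rank (S : Finset ℕ) (d + m) = d := rank_length S
    have h1 := rank_succ (S : Finset ℕ) k
    have h2 := rank_succ (S : Finset ℕ) (k + 1)
    have h3 := rank_word_le S k
    have h4 := rank_word_le S (k + 1)
    have h5 := rank_word_le S (k + 1 + 1)
    have h6 := rank_add_le (S : Finset ℕ) k (d + m - k)
    have h7 := rank_add_le (S : Finset ℕ) (k + 1) (d + m - (k + 1))
    have h8 := rank_add_le (S : Finset ℕ) (k + 1 + 1) (d + m - (k + 1 + 1))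
    rw [Nat.add_sub_cancel' (by omega), e] at h6 h7 h8
    by_cases hk0 : k ∈ (S : Finset ℕ) <;> by_cases hk1 : k + 1 ∈ (S : Finset ℕ)
    · exact iff_of_true hk0 hk1
    · rw [if_pos hk0] at h1
      rw [if_neg hk1] at h2
      omega
    · rw [if_neg hk0] at h1
      rw [if_pos hk1] at h2
      omega
    · exact iff_of_false hk0 hk1

theorem descProd_wordExch_row {d m r : ℕ} (hr : r < d) :
    descProd (wordExch (d + m) d r) m =
      descProd (fun k => if r ≤ k ∧ k < r + m then wordExch (d + m) d r (k - r) else 1)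
        (d + m - 1) := by
  obtain ⟨t, rfl⟩ : ∃ t, d = r + 1 + t := ⟨d - (r + 1), by omega⟩
  rw [show r + 1 + t + m - 1 = r + m + t by omega, descProd_add, descProd_add]
  have h1 : descProd (fun k => if r ≤ k ∧ k < r + m then
      wordExch (r + 1 + t + m) (r + 1 + t) r (k - r) else 1) r = 1 := by
    refine (descProd_congr fun k hk => ?_).trans (descProd_one r)
    exact if_neg (by omega)
  have h2 : descProd (fun k => if r ≤ r + m + k ∧ r + m + k < r + m then
      wordExch (r + 1 + t + m) (r + 1 + t) r (r + m + k - r) else 1) t = 1 := by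
    refine (descProd_congr fun k hk => ?_).trans (descProd_one t)
    exact if_neg (by omega)
  rw [h1, h2, one_mul, mul_one]
  refine descProd_congr fun k hk => ?_
  rw [if_pos (by omega), Nat.add_sub_cancel_left]

/-- Taking all exchanges row by row amounts to the rotation of words: regroup them by
antidiagonals. -/
theorem descProd_descProd_wordExch (d m : ℕ) :
    descProd (fun r => descProd (wordExch (d + m) d r) m) d = wordRot (d + m) d := by
  rw [descProd_congr fun r hr => descProd_wordExch_row hr, wordRot,
    ← descProd_congr (f := fun k => descProd (fun r => if r ≤ k ∧ k < r + m then
      wordExch (d + m) d r (k - r) else 1) d)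
      fun k hk => descProd_wordExch_antidiagonal (by omega)]
  simp only [descProd_eq_prod _ d]
  symm
  apply descProd_list_prod_comm
  rw [List.pairwise_reverse]
  refine List.pairwise_lt_range.imp ?_
  intro r' r hr i j hij _
  split_ifs
  · exact wordExch_comm (Or.inr (Or.inl (by omega)))
  all_goals exact Commute.one_left _

/-- The product of all exchange operators, with rows and columns taken in arbitrary orders, is
conjugate to the rotation of words. -/
theorem isConj_prod_wordExch_wordRot {d m : ℕ} {rs cs : List ℕ} (hr : rs.Perm (List.range d))
    (hc : cs.Perm (List.range m)) :
    IsConj (cs.map fun c => (rs.map fun r => wordExch (d + m) d r c).prod).prod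
      (wordRot (d + m) d) := by
  have h1 := isConj_prod_descProd
    (g := fun c => (rs.map fun r => wordExch (d + m) d r c).prod) (by
      intro i j hij
      refine Commute.list_prod_right _ _ fun x hx => Commute.list_prod_left _ _ fun y hy => ?_
      obtain ⟨r, _, rfl⟩ := List.mem_map.1 hx
      obtain ⟨r', _, rfl⟩ := List.mem_map.1 hy
      exact wordExch_comm (Or.inr (Or.inl hij))) hc
  refine h1.trans ?_
  rw [descProd_list_prod_comm (f := fun r c => wordExch (d + m) d r c) (l := rs),
    ← descProd_descProd_wordExch]
  · refine isConj_prod_descProd (g := fun r => descProd (wordExch (d + m) d r) m) ?_ hr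
    intro i j hij
    refine commute_descProd fun c _ => (commute_descProd fun c' _ => ?_).symm
    exact (wordExch_comm (Or.inl hij)).symm
  · refine (hr.nodup_iff.2 List.nodup_range).imp ?_
    intro r r' hrr i j hij _
    exact wordExch_comm (Or.inr (Or.inr ⟨hrr, hij.ne⟩))

/-! ### Labelings as words with ordered coins and vacancies -/

theorem exists_mem_rank_eq {S : Finset ℕ} {i : ℕ} : ∀ {k : ℕ}, i < rank S k →
    ∃ v < k, v ∈ S ∧ rank S v = i := by
  intro k
  induction k with
  | zero => intro h; simp [rank] at h
  | succ k ih =>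
    intro h
    by_cases hk : i < rank S k
    · obtain ⟨v, hv, h'⟩ := ih hk
      exact ⟨v, by omega, h'⟩
    · rw [rank_succ] at h
      refine ⟨k, k.lt_succ_self, ?_⟩
      split_ifs at h with hS
      · exact ⟨hS, by omega⟩
      · omega

theorem exists_notMem_sub_rank_eq {S : Finset ℕ} {j : ℕ} : ∀ {k : ℕ}, j < k - rank S k →
    ∃ v < k, v ∉ S ∧ v - rank S v = j := by
  intro k
  induction k with
  | zero => intro h; simp at h
  | succ k ih =>
    intro h
    by_cases hk : j < k - rank S k
    · obtain ⟨v, hv, h'⟩ := ih hk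
      exact ⟨v, by omega, h'⟩
    · rw [rank_succ] at h
      refine ⟨k, k.lt_succ_self, ?_⟩
      split_ifs at h with hS
      · omega
      · exact ⟨hS, by omega⟩

theorem eq_of_rank_eq {S : Finset ℕ} {v w : ℕ} (hv : v ∈ S) (hw : w ∈ S)
    (h : rank S v = rank S w) : v = w := Nat.count_injective hv hw h

theorem sub_rank_lt_sub_rank {S : Finset ℕ} {v w : ℕ} (hv : v ∉ S) (h : v < w) :
    v - rank S v < w - rank S w := by
  have h1 := rank_add_le S (v + 1) (w - (v + 1))
  rw [rank_succ, if_neg hv, Nat.add_sub_cancel' h] at h1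
  have := rank_le S v
  omega

theorem eq_of_sub_rank_eq {S : Finset ℕ} {v w : ℕ} (hv : v ∉ S) (hw : w ∉ S)
    (h : v - rank S v = w - rank S w) : v = w := by
  rcases lt_trichotomy v w with h1 | h1 | h1
  · have := sub_rank_lt_sub_rank hv h1
    omega
  · exact h1
  · have := sub_rank_lt_sub_rank hw h1
    omega

theorem rank_lt_of_mem {n d v : ℕ} {S : Word n d} (hv : v ∈ S.1) : rank S v < d := by
  have h := rank_word_le S (v + 1)
  rw [rank_succ, if_pos hv] at h
  omega

theorem sub_rank_lt_of_notMem {d m v : ℕ} {S : Word (d + m) d} (hv : v ∉ S.1)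
    (hvn : v < d + m) : v - rank S v < m := by
  have h := sub_rank_lt_sub_rank hv hvn
  rw [rank_length S] at h
  omega

/-- The label at position `v` of the word `S` whose coins carry, from left to right, the labels
`a 0, a 1, …`, and whose vacancies carry the labels `b 0, b 1, …`. -/
def wordLabel {R : Type*} (a b : ℕ → R) (S : Finset ℕ) (v : ℕ) : R :=
  if v ∈ S then a (rank S v) else b (v - rank S v)

/-- The labeling `σ` puts the labels `a 0, a 1, …` on the coins of `S`, from left to right, and
`b 0, b 1, …` on its vacancies. -/
def IsLabeledBy {n : ℕ} (σ : Labeling (Fin n) n) (a b : ℕ → ZMod n) (S : Finset ℕ) : Prop :=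
  ∀ v : Fin n, σ v = wordLabel a b S v

theorem IsLabeledBy.congr {d m : ℕ} {σ : Labeling (Fin (d + m)) (d + m)}
    {a b a' b' : ℕ → ZMod (d + m)} {S : Word (d + m) d} (h : IsLabeledBy σ a b S)
    (ha : ∀ i < d, a i = a' i) (hb : ∀ j < m, b j = b' j) : IsLabeledBy σ a' b' S := by
  intro v
  rw [h v, wordLabel, wordLabel]
  split_ifs with hv
  · exact ha _ (rank_lt_of_mem hv)
  · exact hb _ (sub_rank_lt_of_notMem hv v.2)

theorem IsLabeledBy.eq {n : ℕ} {σ τ : Labeling (Fin n) n} {a b : ℕ → ZMod n} {S : Finset ℕ}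
    (h : IsLabeledBy σ a b S) (h' : IsLabeledBy τ a b S) : σ = τ :=
  Equiv.ext fun v => (h v).trans (h' v).symm

theorem wordLabel_adjSwap_of_ne {R : Type*} (a b : ℕ → R) (S : Finset ℕ) {k y : ℕ} (h : y ≠ k)
    (h' : y ≠ k + 1) : wordLabel a b (adjSwap k S) y = wordLabel a b S y := by
  rw [wordLabel, wordLabel, rank_adjSwap h']
  refine if_congr ?_ rfl rfl
  rw [mem_adjSwap, Equiv.swap_apply_of_ne_of_ne h h']

theorem wordLabel_comp {R R' : Type*} (f : R → R') (a b : ℕ → R) (S : Finset ℕ) (y : ℕ) :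
    wordLabel (f ∘ a) (f ∘ b) S y = f (wordLabel a b S y) := by
  rw [wordLabel, wordLabel]
  split_ifs <;> rfl

theorem wordLabel_coin_vacancy {R : Type*} (a b : ℕ → R) {S : Finset ℕ} {k : ℕ} (h : k ∈ S)
    (h' : k + 1 ∉ S) :
    wordLabel a b (adjSwap k S) k = b (k - rank S k) ∧
      wordLabel a b (adjSwap k S) (k + 1) = a (rank S k) := by
  have h1 : k ∉ adjSwap k S := by rwa [mem_adjSwap, Equiv.swap_apply_left]
  have h2 : k + 1 ∈ adjSwap k S := by rwa [mem_adjSwap, Equiv.swap_apply_right]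
  have h3 : rank (adjSwap k S) k = rank S k := rank_adjSwap (by omega) S
  rw [wordLabel, wordLabel, if_neg h1, if_pos h2, rank_succ, if_neg h1, h3]
  exact ⟨rfl, rfl⟩

theorem wordLabel_vacancy_coin {R : Type*} (a b : ℕ → R) {S : Finset ℕ} {k : ℕ} (h : k ∉ S)
    (h' : k + 1 ∈ S) :
    wordLabel a b (adjSwap k S) k = a (rank S k) ∧
      wordLabel a b (adjSwap k S) (k + 1) = b (k - rank S k) := by
  have h1 : k ∈ adjSwap k S := by rwa [mem_adjSwap, Equiv.swap_apply_left]
  have h2 : k + 1 ∉ adjSwap k S := by rwa [mem_adjSwap, Equiv.swap_apply_right]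
  have h3 : rank (adjSwap k S) k = rank S k := rank_adjSwap (by omega) S
  rw [wordLabel, wordLabel, if_pos h1, if_neg h2, rank_succ, if_pos h1, h3,
    Nat.add_sub_add_right]
  exact ⟨rfl, rfl⟩

/-- The effect of a toggle on a coin and a vacancy carrying consecutive labels: the two labels
always trade their roles, and the coin and the vacancy exchange places if they are adjacent on
the path. (Then both changes together leave the labeling as it is.) In particular the
left-to-right order of the coins, and that of the vacancies, is preserved. -/
theorem IsLabeledBy.toggle {d m : ℕ} {σ : Labeling (Fin (d + m)) (d + m)}
    {a b : ℕ → ZMod (d + m)} {S : Word (d + m) d} (h : IsLabeledBy σ a b S) {i j : ℕ}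
    (hi : i < d) (hj : j < m) {k : ZMod (d + m)} (ha : a i = k) (hb : b j = k + 1) :
    IsLabeledBy (toggle (SimpleGraph.pathGraph (d + m)) k σ) (Equiv.swap k (k + 1) ∘ a)
      (Equiv.swap k (k + 1) ∘ b) (wordExch (d + m) d i j S) := by
  obtain ⟨v, hvn, hvS, hv⟩ := exists_mem_rank_eq (S := S.1) (i := i) (k := d + m)
    (by rwa [rank_length S])
  obtain ⟨x, hxn, hxS, hx⟩ := exists_notMem_sub_rank_eq (S := S.1) (j := j) (k := d + m)
    (by rw [rank_length S]; omega)
  have hσv : σ ⟨v, hvn⟩ = k := by rw [h, wordLabel, if_pos hvS, hv, ha]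
  have hσx : σ ⟨x, hxn⟩ = k + 1 := by rw [h, wordLabel, if_neg hxS, hx, hb]
  have hv' : σ.symm k = ⟨v, hvn⟩ := by rw [← hσv, σ.symm_apply_apply]
  have hx' : σ.symm (k + 1) = ⟨x, hxn⟩ := by rw [← hσx, σ.symm_apply_apply]
  have htog : PermutoricPromotion.toggle (SimpleGraph.pathGraph (d + m)) k σ =
      if v + 1 = x ∨ x + 1 = v then σ else σ.trans (Equiv.swap k (k + 1)) := by
    change toggleFun _ _ _ = _
    rw [toggleFun, hv', hx']
    refine if_congr ?_ rfl rfl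
    rw [SimpleGraph.pathGraph_adj]
  have hrx := rank_le S.1 x
  have hrv := rank_le S.1 v
  intro y
  rw [htog, coe_wordExch (by omega), exch_apply]
  have hother : (y : ℕ) ≠ v → (y : ℕ) ≠ x → Equiv.swap k (k + 1) (σ y) = σ y := by
    intro h1 h2
    refine Equiv.swap_apply_of_ne_of_ne ?_ ?_
    · rw [← hσv]
      exact fun e => h1 (congrArg Fin.val (σ.injective e))
    · rw [← hσx]
      exact fun e => h2 (congrArg Fin.val (σ.injective e))
  by_cases h1 : v + 1 = x
  · subst h1
    rw [rank_succ, if_pos hvS] at hx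
    have e : i + j = v := by omega
    obtain ⟨e1, e2⟩ := wordLabel_coin_vacancy a b hvS hxS
    rw [if_pos (Or.inl rfl), e, if_pos hv, wordLabel_comp]
    by_cases y1 : (y : ℕ) = v
    · rw [y1, e1, hv, show v - i = j by omega, hb, Equiv.swap_apply_right, ← hσv]
      exact congrArg σ (Fin.ext y1)
    by_cases y2 : (y : ℕ) = v + 1
    · rw [y2, e2, hv, ha, Equiv.swap_apply_left, ← hσx]
      exact congrArg σ (Fin.ext y2)
    rw [wordLabel_adjSwap_of_ne _ _ _ y1 y2, ← h y, hother y1 y2]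
  by_cases h2 : x + 1 = v
  · subst h2
    rw [rank_succ, if_neg hxS] at hv
    have e : i + j = x := by omega
    obtain ⟨e1, e2⟩ := wordLabel_vacancy_coin a b hxS hvS
    rw [if_pos (Or.inr rfl), e, if_pos (by omega), wordLabel_comp]
    by_cases y1 : (y : ℕ) = x
    · rw [y1, e1, show rank S.1 x = i by omega, ha, Equiv.swap_apply_left, ← hσx]
      exact congrArg σ (Fin.ext y1)
    by_cases y2 : (y : ℕ) = x + 1
    · rw [y2, e2, hx, hb, Equiv.swap_apply_right, ← hσv]
      exact congrArg σ (Fin.ext y2)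
    rw [wordLabel_adjSwap_of_ne _ _ _ y1 y2, ← h y, hother y2 y1]
  rw [if_neg (by omega), Equiv.trans_apply, wordLabel_comp, h y]
  refine congrArg _ (congrArg (fun T => wordLabel a b T y) ?_)
  split_ifs with hr
  · symm
    apply adjSwap_eq_self
    by_cases hk : i + j ∈ S.1
    · refine iff_of_true hk ?_
      by_contra hk'
      have e1 : i + j = v := eq_of_rank_eq hk hvS (hr.trans hv.symm)
      have e2 : i + j + 1 = x := eq_of_sub_rank_eq hk' hxS (by
        rw [rank_succ, if_pos hk]
        omega)
      omega
    · refine iff_of_false hk fun hk' => ?_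
      have e1 : i + j + 1 = v := eq_of_rank_eq hk' hvS (by
        rw [rank_succ, if_neg hk]
        omega)
      have e2 : i + j = x := eq_of_sub_rank_eq hk hxS (by omega)
      omega
  · rfl

theorem natCast_inj_of_le {n x y : ℕ} (hx : 1 ≤ x) (hxn : x ≤ n) (hy : 1 ≤ y) (hyn : y ≤ n) :
    (x : ZMod n) = y ↔ x = y := by
  refine ⟨fun h => ?_, fun h => by rw [h]⟩
  rw [ZMod.natCast_eq_natCast_iff] at h
  rcases le_total x y with hl | hl
  · have := Nat.eq_zero_of_dvd_of_lt ((Nat.modEq_iff_dvd' hl).1 h) (by omega)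
    omega
  · have := Nat.eq_zero_of_dvd_of_lt ((Nat.modEq_iff_dvd' hl).1 h.symm) (by omega)
    omega

theorem swap_natCast {n k x : ℕ} (hk : 1 ≤ k) (hkn : k + 1 ≤ n) (hx : 1 ≤ x) (hxn : x ≤ n) :
    Equiv.swap (k : ZMod n) (k + 1) x = ((Equiv.swap k (k + 1) x : ℕ) : ZMod n) := by
  have h1 := natCast_inj_of_le hx hxn hk (by omega)
  have h2 := natCast_inj_of_le hx hxn (y := k + 1) (by omega) hkn
  rw [Nat.cast_succ] at h2
  rw [Equiv.swap_apply_def, Equiv.swap_apply_def, if_congr h1 rfl rfl, if_congr h2 rfl rfl]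
  split_ifs <;> simp

/-- The current label of the line that starts at the label `r + 1`, where `r < d`, when the lines
starting at `d + 1, …, d + i` have been moved past all the lines of this kind, and
the one starting at `d + i + 1` past those with `s ≤ r`. -/
def rowLabel (i s r : ℕ) : ℕ := if s ≤ r then i + r + 2 else i + r + 1

/-- The current label of the line that starts at the label `d + c + 1`, at the same moment as in
`rowLabel`. -/
def colLabel (d i s c : ℕ) : ℕ := if c < i then c + 1 else if c = i then i + s + 1 else d + c + 1

theorem swap_rowLabel {i s r : ℕ} :
    Equiv.swap (i + 1 + s) (i + 1 + s + 1) (rowLabel i (s + 1) r) = rowLabel i s r := by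
  rw [Equiv.swap_apply_def, rowLabel, rowLabel]
  split_ifs <;> omega

theorem swap_colLabel {d i s c : ℕ} (hs : s < d) :
    Equiv.swap (i + 1 + s) (i + 1 + s + 1) (colLabel d i (s + 1) c) = colLabel d i s c := by
  rw [Equiv.swap_apply_def, colLabel, colLabel]
  split_ifs <;> omega

theorem IsLabeledBy.toggleRun_aux {d m : ℕ} {α β : Equiv.Perm ℕ} (hα : ∀ t, α t < d ↔ t < d)
    (hβ : ∀ t, β t < m ↔ t < m) {i : ℕ} (hi : i < m)
    {σ : Labeling (Fin (d + m)) (d + m)} {S : Word (d + m) d}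
    (h : IsLabeledBy σ (fun t => (rowLabel i d (α t) : ZMod (d + m)))
      (fun t => (colLabel d i d (β t) : ZMod (d + m))) S) (e : ℕ) :
    ∀ s, s + e = d → IsLabeledBy
      (((List.range' s e).map fun j : ℕ => PermutoricPromotion.toggle
        (SimpleGraph.pathGraph (d + m)) ((i + 1 + j : ℕ) : ZMod (d + m))).prod σ)
      (fun t => (rowLabel i s (α t) : ZMod (d + m)))
      (fun t => (colLabel d i s (β t) : ZMod (d + m)))
      (((List.range' s e).map fun r => wordExch (d + m) d (α.symm r) (β.symm i)).prod S :
        Word (d + m) d) := by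
  induction e with
  | zero =>
    intro s hs
    obtain rfl : s = d := by omega
    exact h
  | succ e ih =>
    intro s hs
    rw [List.range'_succ, List.map_cons, List.map_cons, List.prod_cons, List.prod_cons,
      Equiv.Perm.mul_apply, Equiv.Perm.mul_apply]
    have h1 := (ih (s + 1) (by omega)).toggle (i := α.symm s) (j := β.symm i)
      (by rw [← hα, α.apply_symm_apply]; omega) (by rwa [← hβ, β.apply_symm_apply])
      (k := ((i + 1 + s : ℕ) : ZMod (d + m)))
      (by
        simp only [α.apply_symm_apply]
        congr 1
        rw [rowLabel, if_neg (by omega)]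
        omega)
      (by
        simp only [β.apply_symm_apply]
        rw [← Nat.cast_succ]
        congr 1
        rw [colLabel, if_neg (by omega), if_pos rfl]
        omega)
    refine h1.congr (fun t ht => ?_) fun t ht => ?_
    · have ht' := (hα t).2 ht
      simp only [Function.comp_apply]
      rw [swap_natCast (by omega) (by omega), swap_rowLabel]
      all_goals
        rw [rowLabel]
        split_ifs <;> omega
    · have ht' := (hβ t).2 ht
      simp only [Function.comp_apply]
      rw [swap_natCast (by omega) (by omega), swap_colLabel (by omega)]
      all_goals
        rw [colLabel]
        split_ifs <;> omega

theorem IsLabeledBy.toggleRun {d m : ℕ} {α β : Equiv.Perm ℕ} (hα : ∀ t, α t < d ↔ t < d)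
    (hβ : ∀ t, β t < m ↔ t < m) {i : ℕ} (hi : i < m)
    {σ : Labeling (Fin (d + m)) (d + m)} {S : Word (d + m) d}
    (h : IsLabeledBy σ (fun t => (rowLabel i d (α t) : ZMod (d + m)))
      (fun t => (colLabel d i d (β t) : ZMod (d + m))) S) :
    IsLabeledBy (toggleRun (d + m) d (i + 1) σ)
      (fun t => (rowLabel (i + 1) d (α t) : ZMod (d + m)))
      (fun t => (colLabel d (i + 1) d (β t) : ZMod (d + m)))
      (((List.range d).map fun r => wordExch (d + m) d (α.symm r) (β.symm i)).prod S :
        Word (d + m) d) := by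
  have h1 := IsLabeledBy.toggleRun_aux hα hβ hi h d 0 (by omega)
  rw [← List.range_eq_range'] at h1
  refine IsLabeledBy.congr h1 (fun t ht => ?_) fun t ht => ?_
  · have ht' := (hα t).2 ht
    congr 1
    rw [rowLabel, rowLabel]
    split_ifs <;> omega
  · congr 1
    rw [colLabel, colLabel]
    split_ifs <;> omega

theorem IsLabeledBy.toggleRuns {d m : ℕ} {α β : Equiv.Perm ℕ} (hα : ∀ t, α t < d ↔ t < d)
    (hβ : ∀ t, β t < m ↔ t < m) {σ : Labeling (Fin (d + m)) (d + m)} {S : Word (d + m) d}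
    (h : IsLabeledBy σ (fun t => (rowLabel 0 d (α t) : ZMod (d + m)))
      (fun t => (colLabel d 0 d (β t) : ZMod (d + m))) S) {i : ℕ} (hi : i ≤ m) :
    IsLabeledBy
      (((List.range i).reverse.map fun i : ℕ => PermutoricPromotion.toggleRun (d + m) d
        (i + 1)).prod σ)
      (fun t => (rowLabel i d (α t) : ZMod (d + m)))
      (fun t => (colLabel d i d (β t) : ZMod (d + m)))
      (((List.range i).reverse.map fun c => ((List.range d).map fun r =>
        wordExch (d + m) d (α.symm r) (β.symm c)).prod).prod S : Word (d + m) d) := by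
  induction i with
  | zero => exact h
  | succ i ih =>
    simp only [List.range_succ, List.reverse_append, List.reverse_singleton, List.map_append,
      List.map_singleton, List.prod_append, List.prod_singleton, Equiv.Perm.mul_apply]
    exact (ih (by omega)).toggleRun hα hβ (by omega)

theorem cyc_pow_apply {n : ℕ} (k : ℕ) (σ : Labeling (Fin n) n) (v : Fin n) :
    ((cyc (Fin n) n ^ k) σ) v = σ v + k := by
  induction k with
  | zero => simp
  | succ k ih =>
    rw [pow_succ', Equiv.Perm.mul_apply]
    change ((cyc (Fin n) n ^ k) σ) v + 1 = _
    rw [ih, Nat.cast_succ, add_assoc]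

/-- `Φ` preserves the order of the coins and that of the vacancies, and acts on the set of
positions of the coins by a product of all exchange operators. -/
theorem IsLabeledBy.phi {d m : ℕ} {α β : Equiv.Perm ℕ} (hα : ∀ t, α t < d ↔ t < d)
    (hβ : ∀ t, β t < m ↔ t < m) {σ : Labeling (Fin (d + m)) (d + m)} {S : Word (d + m) d}
    (h : IsLabeledBy σ (fun t => ((α t + 1 : ℕ) : ZMod (d + m)))
      (fun t => ((d + β t + 1 : ℕ) : ZMod (d + m))) S) :
    IsLabeledBy (Phi (d + m) d σ) (fun t => ((α t + 1 : ℕ) : ZMod (d + m)))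
      (fun t => ((d + β t + 1 : ℕ) : ZMod (d + m)))
      (((List.range m).reverse.map fun c => ((List.range d).map fun r =>
        wordExch (d + m) d (α.symm r) (β.symm c)).prod).prod S : Word (d + m) d) := by
  have h0 : IsLabeledBy σ (fun t => (rowLabel 0 d (α t) : ZMod (d + m)))
      (fun t => (colLabel d 0 d (β t) : ZMod (d + m))) S := by
    refine h.congr (fun t ht => ?_) fun t ht => ?_
    · have ht' := (hα t).2 ht
      congr 1
      rw [rowLabel, if_neg (by omega)]
      omega
    · congr 1
      rw [colLabel]
      split_ifs <;> omega
  have h1 := h0.toggleRuns hα hβ le_rfl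
  rw [Phi, Nat.add_sub_cancel_left, Equiv.Perm.mul_apply]
  set τ := (((List.range m).reverse.map fun i : ℕ => PermutoricPromotion.toggleRun (d + m) d
        (i + 1)).prod σ)
  have h2 : IsLabeledBy ((cyc (Fin (d + m)) (d + m) ^ d) τ)
      ((· + (d : ZMod (d + m))) ∘ fun t => (rowLabel m d (α t) : ZMod (d + m)))
      ((· + (d : ZMod (d + m))) ∘ fun t => (colLabel d m d (β t) : ZMod (d + m)))
      (((List.range m).reverse.map fun c => ((List.range d).map fun r =>
        wordExch (d + m) d (α.symm r) (β.symm c)).prod).prod S : Word (d + m) d) := by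
    intro v
    rw [wordLabel_comp, cyc_pow_apply, h1 v]
  refine h2.congr (fun t ht => ?_) fun t ht => ?_
  · have ht' := (hα t).2 ht
    simp only [Function.comp_apply]
    rw [rowLabel, if_neg (by omega), ← Nat.cast_add,
      show m + α t + 1 + d = α t + 1 + (d + m) by omega, Nat.cast_add _ (d + m),
      ZMod.natCast_self, add_zero]
  · have ht' := (hβ t).2 ht
    simp only [Function.comp_apply]
    rw [colLabel, if_pos ht', ← Nat.cast_add]
    congr 1
    omega

/-- The extension of a permutation of `Fin d` to `ℕ` by the identity. -/
def natPerm {d : ℕ} (α : Equiv.Perm (Fin d)) : Equiv.Perm ℕ := α.extendDomain Fin.equivSubtype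

theorem natPerm_coe {d : ℕ} (α : Equiv.Perm (Fin d)) (t : Fin d) : natPerm α t = α t :=
  α.extendDomain_apply_image Fin.equivSubtype t

theorem natPerm_lt {d : ℕ} (α : Equiv.Perm (Fin d)) (t : ℕ) : natPerm α t < d ↔ t < d := by
  by_cases h : t < d
  · have := natPerm_coe α ⟨t, h⟩
    simp only at this
    rw [this]
    exact iff_of_true (α ⟨t, h⟩).2 h
  · rw [natPerm, α.extendDomain_apply_not_subtype Fin.equivSubtype h]

/-- The labels of the coins are `1, …, d`, in the order given by `α`, and the labels of the
vacancies are `d + 1, …, d + m`, in the order given by `β`. -/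
def labelOf {d m : ℕ} (α : Equiv.Perm (Fin d)) (β : Equiv.Perm (Fin m)) (S : Word (d + m) d)
    (v : ℕ) : ℕ :=
  wordLabel (fun t => natPerm α t + 1) (fun t => d + natPerm β t + 1) S v

theorem labelOf_of_mem {d m : ℕ} {α : Equiv.Perm (Fin d)} {β : Equiv.Perm (Fin m)}
    {S : Word (d + m) d} {v : ℕ} (hv : v ∈ S.1) :
    labelOf α β S v = natPerm α (rank S v) + 1 ∧ labelOf α β S v ≤ d := by
  have h : labelOf α β S v = natPerm α (rank S v) + 1 := by rw [labelOf, wordLabel, if_pos hv]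
  have := (natPerm_lt α _).2 (rank_lt_of_mem hv)
  exact ⟨h, by omega⟩

theorem labelOf_of_notMem {d m : ℕ} {α : Equiv.Perm (Fin d)} {β : Equiv.Perm (Fin m)}
    {S : Word (d + m) d} {v : ℕ} (hvn : v < d + m) (hv : v ∉ S.1) :
    labelOf α β S v = d + natPerm β (v - rank S v) + 1 ∧ labelOf α β S v ≤ d + m := by
  have h : labelOf α β S v = d + natPerm β (v - rank S v) + 1 := by
    rw [labelOf, wordLabel, if_neg hv]
  have := (natPerm_lt β _).2 (sub_rank_lt_of_notMem hv hvn)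
  exact ⟨h, by omega⟩

theorem mem_iff_labelOf_le {d m : ℕ} {α : Equiv.Perm (Fin d)} {β : Equiv.Perm (Fin m)}
    {S : Word (d + m) d} {v : ℕ} (hvn : v < d + m) : v ∈ S.1 ↔ labelOf α β S v ≤ d := by
  refine ⟨fun h => (labelOf_of_mem h).2, fun h => ?_⟩
  by_contra hv
  have := labelOf_of_notMem (α := α) (β := β) hvn hv
  omega

theorem labelOf_mem_Icc {d m : ℕ} (α : Equiv.Perm (Fin d)) (β : Equiv.Perm (Fin m))
    (S : Word (d + m) d) {v : ℕ} (hvn : v < d + m) :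
    1 ≤ labelOf α β S v ∧ labelOf α β S v ≤ d + m := by
  by_cases hv : v ∈ S.1
  · have := labelOf_of_mem (α := α) (β := β) hv
    omega
  · have := labelOf_of_notMem (α := α) (β := β) hvn hv
    omega

theorem labelOf_injOn {d m : ℕ} (α : Equiv.Perm (Fin d)) (β : Equiv.Perm (Fin m))
    (S : Word (d + m) d) {v w : ℕ} (hv : v < d + m) (hw : w < d + m)
    (h : labelOf α β S v = labelOf α β S w) : v = w := by
  have hiff : v ∈ S.1 ↔ w ∈ S.1 := by
    rw [mem_iff_labelOf_le (α := α) (β := β) hv, h, ← mem_iff_labelOf_le hw]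
  by_cases hS : v ∈ S.1
  · rw [(labelOf_of_mem hS).1, (labelOf_of_mem (hiff.1 hS)).1] at h
    exact eq_of_rank_eq hS (hiff.1 hS) ((natPerm α).injective (by omega))
  · have hS' := fun h' => hS (hiff.2 h')
    rw [(labelOf_of_notMem hv hS).1, (labelOf_of_notMem hw hS').1] at h
    exact eq_of_sub_rank_eq hS hS' ((natPerm β).injective (by omega))

/-- The labeling whose labels `1, …, d` occupy the coins of the word `S`, in the order `α`, and
whose other labels occupy the vacancies, in the order `β`. -/
noncomputable def ofWord {d m : ℕ} [NeZero (d + m)] (α : Equiv.Perm (Fin d))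
    (β : Equiv.Perm (Fin m)) (S : Word (d + m) d) : Labeling (Fin (d + m)) (d + m) :=
  Equiv.ofBijective (fun v => ((labelOf α β S v : ℕ) : ZMod (d + m))) (by
    rw [Fintype.bijective_iff_injective_and_card]
    refine ⟨fun v w h => ?_, by rw [ZMod.card, Fintype.card_fin]⟩
    have hv := labelOf_mem_Icc α β S v.2
    have hw := labelOf_mem_Icc α β S w.2
    exact Fin.ext (labelOf_injOn α β S v.2 w.2
      ((natCast_inj_of_le hv.1 hv.2 hw.1 hw.2).1 h)))

theorem isLabeledBy_ofWord {d m : ℕ} [NeZero (d + m)] (α : Equiv.Perm (Fin d))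
    (β : Equiv.Perm (Fin m)) (S : Word (d + m) d) :
    IsLabeledBy (ofWord α β S) (fun t => ((natPerm α t + 1 : ℕ) : ZMod (d + m)))
      (fun t => ((d + natPerm β t + 1 : ℕ) : ZMod (d + m))) S := by
  intro v
  exact (wordLabel_comp (Nat.cast : ℕ → ZMod (d + m)) (fun t => natPerm α t + 1)
    (fun t => d + natPerm β t + 1) S v).symm

theorem ofWord_injective {d m : ℕ} [NeZero (d + m)] :
    Function.Injective fun x : (Equiv.Perm (Fin d) × Equiv.Perm (Fin m)) × Word (d + m) d =>
      ofWord x.1.1 x.1.2 x.2 := by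
  rintro ⟨⟨α, β⟩, S⟩ ⟨⟨α', β'⟩, S'⟩ h
  simp only at h
  have hl : ∀ v < d + m, labelOf α β S v = labelOf α' β' S' v := by
    intro v hv
    have h1 := labelOf_mem_Icc α β S hv
    have h2 := labelOf_mem_Icc α' β' S' hv
    exact (natCast_inj_of_le h1.1 h1.2 h2.1 h2.2).1
      (congrArg (fun σ : Labeling (Fin (d + m)) (d + m) => σ ⟨v, hv⟩) h)
  obtain rfl : S = S' := by
    apply Subtype.ext
    ext v
    by_cases hv : v < d + m
    · rw [mem_iff_labelOf_le (α := α) (β := β) hv, hl v hv, ← mem_iff_labelOf_le hv]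
    · refine iff_of_false (fun h' => ?_) fun h' => ?_
      · exact hv (Finset.mem_range.1 ((Finset.mem_powersetCard.1 S.2).1 h'))
      · exact hv (Finset.mem_range.1 ((Finset.mem_powersetCard.1 S'.2).1 h'))
  obtain rfl : α = α' := by
    ext i
    obtain ⟨v, hv, hvS, hr⟩ := exists_mem_rank_eq (S := S.1) (i := i) (k := d + m)
      (by rw [rank_length S]; exact i.2)
    have := hl v hv
    rw [(labelOf_of_mem hvS).1, (labelOf_of_mem hvS).1, hr, natPerm_coe, natPerm_coe] at this
    omega
  obtain rfl : β = β' := by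
    ext i
    have hi := i.2
    obtain ⟨v, hv, hvS, hr⟩ := exists_notMem_sub_rank_eq (S := S.1) (j := i) (k := d + m)
      (by rw [rank_length S]; omega)
    have := hl v hv
    rw [(labelOf_of_notMem hv hvS).1, (labelOf_of_notMem hv hvS).1, hr, natPerm_coe,
      natPerm_coe] at this
    omega
  rfl

theorem ofWord_bijective {d m : ℕ} [NeZero (d + m)] :
    Function.Bijective fun x : (Equiv.Perm (Fin d) × Equiv.Perm (Fin m)) × Word (d + m) d =>
      ofWord x.1.1 x.1.2 x.2 := by
  rw [Fintype.bijective_iff_injective_and_card]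
  refine ⟨ofWord_injective, ?_⟩
  have e : Fin (d + m) ≃ ZMod (d + m) := Fintype.equivOfCardEq (by simp [ZMod.card])
  rw [Fintype.card_prod, Fintype.card_prod, Fintype.card_perm, Fintype.card_perm,
    Fintype.card_fin, Fintype.card_fin, Fintype.card_coe, Finset.card_powersetCard,
    Finset.card_range, Fintype.card_equiv e, Fintype.card_fin, mul_comm, ← mul_assoc,
    Nat.choose_symm_add]
  exact Nat.add_choose_mul_factorial_mul_factorial d m

theorem map_natPerm_symm_perm {d : ℕ} (α : Equiv.Perm (Fin d)) :
    ((List.range d).map (natPerm α).symm).Perm (List.range d) := by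
  rw [List.perm_ext_iff_of_nodup
    (List.nodup_range.map (natPerm α).symm.injective) List.nodup_range]
  intro t
  simp only [List.mem_map, List.mem_range]
  constructor
  · rintro ⟨s, hs, rfl⟩
    rwa [← natPerm_lt α, Equiv.apply_symm_apply]
  · exact fun ht => ⟨natPerm α t, (natPerm_lt α t).2 ht, Equiv.symm_apply_apply _ _⟩

/-- Labelings are parametrized by the two orders and a word in such a way that `Φ` fixes the
orders and rotates the word. -/
theorem exists_equiv_phi (d m : ℕ) [NeZero (d + m)] :
    ∃ E : (Equiv.Perm (Fin d) × Equiv.Perm (Fin m)) × Word (d + m) d ≃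
        Labeling (Fin (d + m)) (d + m),
      ∀ k S, Phi (d + m) d (E (k, S)) = E (k, wordRot (d + m) d S) := by
  have hF : ∀ k : Equiv.Perm (Fin d) × Equiv.Perm (Fin m), ∃ f h : Equiv.Perm (Word (d + m) d),
      (∀ S, Phi (d + m) d (ofWord k.1 k.2 S) = ofWord k.1 k.2 (f S)) ∧
        f * h = h * wordRot (d + m) d := by
    intro k
    have hc := isConj_prod_wordExch_wordRot (map_natPerm_symm_perm k.1)
      (((List.reverse_perm (List.range m)).map _).trans (map_natPerm_symm_perm k.2))
    simp only [List.map_map, Function.comp_def] at hc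
    obtain ⟨c, hc⟩ := isConj_iff.1 hc
    refine ⟨_, c⁻¹, fun S => IsLabeledBy.eq (IsLabeledBy.phi (natPerm_lt k.1) (natPerm_lt k.2)
      (isLabeledBy_ofWord k.1 k.2 S)) (isLabeledBy_ofWord k.1 k.2 _), ?_⟩
    rw [← hc]
    group
  choose f h hf hh using hF
  refine ⟨(Equiv.sigmaEquivProd _ _).symm.trans ((Equiv.sigmaCongrRight h).trans
    ((Equiv.sigmaEquivProd _ _).trans (Equiv.ofBijective _ ofWord_bijective))), fun k S => ?_⟩
  change Phi (d + m) d (ofWord k.1 k.2 (h k S)) = ofWord k.1 k.2 (h k (wordRot (d + m) d S))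
  rw [hf, ← Equiv.Perm.mul_apply, hh, Equiv.Perm.mul_apply]

/-! ### Orbits of induced maps -/

theorem zpow_apply_of_semiconj {Y X : Type*} {B : Equiv.Perm Y} {f : Equiv.Perm X} {q : Y → X}
    (h : ∀ y, q (B y) = f (q y)) (i : ℤ) (y : Y) : q ((B ^ i) y) = (f ^ i) (q y) := by
  have hpos : ∀ (k : ℕ) (y : Y), q ((B ^ k) y) = (f ^ k) (q y) := by
    intro k
    induction k with
    | zero => intro y; rfl
    | succ k ih => intro y; rw [pow_succ', pow_succ', Equiv.Perm.mul_apply, h, ih,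
        Equiv.Perm.mul_apply]
  cases i with
  | ofNat k => exact hpos k y
  | negSucc k =>
    rw [zpow_negSucc, zpow_negSucc, Equiv.Perm.eq_inv_iff_eq, ← hpos, ← Equiv.Perm.mul_apply,
      mul_inv_cancel, Equiv.Perm.one_apply]

theorem ncard_preimage_of_fibers {Y X : Type*} [Finite Y] {q : Y → X} {d : ℕ}
    (hq : Function.Surjective q) (h : ∀ x, {y | q y = x}.ncard = d) (O : Set X) :
    (q ⁻¹' O).ncard = d * O.ncard := by
  classical
  have := Finite.of_surjective q hq
  have := Fintype.ofFinite Y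
  have := Fintype.ofFinite X
  rw [Set.ncard_eq_toFinset_card', Set.ncard_eq_toFinset_card',
    Finset.card_eq_sum_card_fiberwise (f := q) (t := O.toFinset) (by intro y hy; simpa using hy),
    Finset.sum_const_nat (m := d), mul_comm]
  intro x hx
  rw [← h x, Set.ncard_eq_toFinset_card']
  congr 1
  ext y
  simp only [Finset.mem_filter, Set.mem_toFinset, Set.mem_preimage, Set.mem_ofPred_eq,
    and_iff_right_iff_imp]
  rintro rfl
  simpa using hx

theorem preimage_orbit {Y X : Type*} {A B : Equiv.Perm Y} {f : Equiv.Perm X} {q : Y → X}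
    (hf : ∀ y, q (B y) = f (q y)) (hA : ∀ y y', q y = q y' ↔ A.SameCycle y y') (y₀ : Y) :
    q ⁻¹' {x | f.SameCycle (q y₀) x} = {y | ∃ i j : ℤ, (A ^ i) ((B ^ j) y₀) = y} := by
  ext y
  constructor
  · rintro ⟨j, hj⟩
    rw [← zpow_apply_of_semiconj hf, hA] at hj
    obtain ⟨i, hi⟩ := hj
    exact ⟨i, j, hi⟩
  · rintro ⟨i, j, hij⟩
    refine ⟨j, ?_⟩
    rw [← zpow_apply_of_semiconj hf, hA]
    exact ⟨i, hij⟩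

/-- Let `A` and `B` be commuting permutations of `Y`, and let `X` and `C` be the quotients of `Y`
by `A` and by `B`. The orbits on `X` of the map induced by `B` and the orbits on `C` of the map
induced by `A` both correspond to the orbits on `Y` of the group generated by `A` and `B`. -/
theorem exists_equiv_orb {Y X C : Type*} [Finite Y] {A B : Equiv.Perm Y} (hAB : Commute A B)
    {f : Equiv.Perm X} {g : Equiv.Perm C} {q : Y → X} {r : Y → C} (hq : Function.Surjective q)
    (hr : Function.Surjective r) (hf : ∀ y, q (B y) = f (q y)) (hg : ∀ y, r (A y) = g (r y))
    (hA : ∀ y y', q y = q y' ↔ A.SameCycle y y') (hB : ∀ y y', r y = r y' ↔ B.SameCycle y y')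
    {d n : ℕ} (hd : ∀ x, {y | q y = x}.ncard = d) (hn : ∀ c, {y | r y = c}.ncard = n) :
    ∃ e : Orb f ≃ Orb g, ∀ O : Orb f, n * (e O : Set C).ncard = d * (O : Set X).ncard := by
  have key : ∀ y₀, q ⁻¹' {x | f.SameCycle (q y₀) x} = r ⁻¹' {c | g.SameCycle (r y₀) c} := by
    intro y₀
    rw [preimage_orbit hf hA, preimage_orbit hg hB]
    ext y
    have hc : ∀ i j : ℤ, (A ^ i) ((B ^ j) y₀) = (B ^ j) ((A ^ i) y₀) := fun i j => by
      rw [← Equiv.Perm.mul_apply, ((hAB.zpow_left i).zpow_right j).eq, Equiv.Perm.mul_apply]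
    exact ⟨fun ⟨i, j, h⟩ => ⟨j, i, by rw [← hc, h]⟩, fun ⟨j, i, h⟩ => ⟨i, j, by rw [hc, h]⟩⟩
  have hmem : ∀ O : Orb f, ∃ y₀, (O : Set X) = {x | f.SameCycle (q y₀) x} := by
    rintro ⟨_, x, rfl⟩
    obtain ⟨y₀, rfl⟩ := hq x
    exact ⟨y₀, rfl⟩
  have hex : ∀ O : Orb f, ∃ O' : Orb g, q ⁻¹' (O : Set X) = r ⁻¹' (O' : Set C) := by
    intro O
    obtain ⟨y₀, h⟩ := hmem O
    exact ⟨⟨_, r y₀, rfl⟩, by rw [h, key]⟩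
  choose e he using hex
  have hbij : Function.Bijective e := by
    constructor
    · intro O₁ O₂ h
      apply Subtype.ext
      apply hq.preimage_injective
      rw [he, he, h]
    · rintro ⟨_, c, rfl⟩
      obtain ⟨y₀, rfl⟩ := hr c
      refine ⟨⟨_, q y₀, rfl⟩, Subtype.ext (hr.preimage_injective ?_)⟩
      rw [← he, key]
  refine ⟨Equiv.ofBijective e hbij, fun O => ?_⟩
  rw [Equiv.ofBijective_apply, ← ncard_preimage_of_fibers hr hn, ← he,
    ncard_preimage_of_fibers hq hd]

/-- The orbits of a map conjugate to `id × f` on `K × X` are the copies of the orbits of `f`. -/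
theorem exists_equiv_orb_prod {K X L : Type*} {F : Equiv.Perm L} {f : Equiv.Perm X}
    (E : K × X ≃ L) (h : ∀ k x, F (E (k, x)) = E (k, f x)) :
    ∃ e : K × Orb f ≃ Orb F, ∀ k O, (e (k, O) : Set L).ncard = (O : Set X).ncard := by
  have key : ∀ k x, {σ | F.SameCycle (E (k, x)) σ} =
      (fun x => E (k, x)) '' {y | f.SameCycle x y} := by
    intro k x
    ext σ
    constructor
    · rintro ⟨i, hi⟩
      refine ⟨(f ^ i) x, ⟨i, rfl⟩, ?_⟩
      rw [← hi]
      exact (zpow_apply_of_semiconj (q := fun x => E (k, x)) (B := f) (f := F)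
        (fun y => (h k y).symm) i x)
    · rintro ⟨_, ⟨i, rfl⟩, rfl⟩
      exact ⟨i, (zpow_apply_of_semiconj (q := fun x => E (k, x)) (B := f) (f := F)
        (fun y => (h k y).symm) i x).symm⟩
  have hinj : ∀ k, Function.Injective fun x => E (k, x) := fun k x y hxy => by
    simpa using E.injective hxy
  have hmem : ∀ (k : K) (O : Orb f), (fun x => E (k, x)) '' (O : Set X) ∈ Orb F := by
    rintro k ⟨_, x, rfl⟩
    exact ⟨E (k, x), key k x⟩
  have hbij : Function.Bijective fun p : K × Orb f => (⟨_, hmem p.1 p.2⟩ : Orb F) := by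
    constructor
    · rintro ⟨k, O⟩ ⟨k', O'⟩ hO
      have hO' : (fun x => E (k, x)) '' (O : Set X) = (fun x => E (k', x)) '' (O' : Set X) :=
        congrArg Subtype.val hO
      obtain rfl : k = k' := by
        obtain ⟨_, x, rfl⟩ := O
        have : E (k, x) ∈ (fun x => E (k', x)) '' (O' : Set X) := by
          rw [← hO']
          exact ⟨x, Equiv.Perm.SameCycle.refl f x, rfl⟩
        obtain ⟨y, _, hy⟩ := this
        exact (congrArg Prod.fst (E.injective hy)).symm
      exact Prod.ext rfl (Subtype.ext ((hinj k).image_injective hO'))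
    · rintro ⟨_, σ, rfl⟩
      obtain ⟨⟨k, x⟩, rfl⟩ := E.surjective σ
      exact ⟨(k, ⟨_, x, rfl⟩), Subtype.ext (key k x).symm⟩
  exact ⟨Equiv.ofBijective _ hbij, fun k O => Set.ncard_image_of_injective _ (hinj k)⟩

/-! ### Orbits of words and of compositions -/

/-- Shifting the base point of a pointed composition back by one position. -/
def shiftBack (n d : ℕ) : Equiv.Perm (Comp n d × ZMod n) :=
  (Equiv.refl _).prodCongr (Equiv.subRight 1)

theorem fst_eq_iff {n d : ℕ} [NeZero n] (y y' : Comp n d × ZMod n) :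
    y.1 = y'.1 ↔ (shiftBack n d).SameCycle y y' := by
  have hpow : ∀ (k : ℕ) (y : Comp n d × ZMod n), (shiftBack n d ^ k) y = (y.1, y.2 - k) := by
    intro k y
    induction k with
    | zero => simp
    | succ k ih =>
      rw [pow_succ', Equiv.Perm.mul_apply, ih]
      exact Prod.ext rfl (by rw [Nat.cast_succ, ← sub_sub]; rfl)
  constructor
  · intro h
    refine ⟨((y.2 - y'.2).val : ℕ), ?_⟩
    rw [zpow_natCast, hpow]
    refine Prod.ext h ?_
    rw [ZMod.natCast_val, ZMod.cast_id, sub_sub_cancel]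
  · rintro ⟨i, rfl⟩
    have := zpow_apply_of_semiconj (B := shiftBack n d) (f := (1 : Equiv.Perm (Comp n d)))
      (q := Prod.fst) (fun _ => rfl) i y
    rw [this, one_zpow, Equiv.Perm.one_apply]

theorem ncard_fst_fiber {n d : ℕ} (a : Comp n d) : {y : Comp n d × ZMod n | y.1 = a}.ncard = n := by
  have : {y : Comp n d × ZMod n | y.1 = a} = Set.range fun p : ZMod n => (a, p) := by
    ext ⟨b, p⟩
    constructor
    · rintro rfl
      exact ⟨p, rfl⟩
    · rintro ⟨_, h⟩
      exact (congrArg Prod.fst h).symm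
  rw [this, ← Set.image_univ, Set.ncard_image_of_injective _ (Prod.mk_right_injective a),
    Set.ncard_univ, Nat.card_zmod]

theorem finite_comp (n d : ℕ) : Finite (Comp n d) := by
  refine Finite.of_injective
    (fun a : Comp n d => fun i : Fin d => (⟨a.1 i, ?_⟩ : Fin (n + 1))) ?_
  · have h : a.1 i ≤ ∑ j, a.1 j := Finset.single_le_sum (fun _ _ => Nat.zero_le _)
      (Finset.mem_univ i)
    rw [a.2.2] at h
    exact Nat.lt_succ_of_le h
  · intro a b h
    apply Subtype.ext
    funext i
    exact congrArg Fin.val (congrFun h i)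

section Composition

variable {n d : ℕ} [NeZero d]

/-- The periodic extension of a composition to all indices. -/
def Comp.part (a : Comp n d) (i : ℕ) : ℕ := a.1 (Fin.ofNat d i)

/-- The partial sums of a composition, extended periodically. -/
def Comp.psum (a : Comp n d) (k : ℕ) : ℕ := ∑ i ∈ Finset.range k, a.part i

theorem Comp.part_pos (a : Comp n d) (i : ℕ) : 0 < a.part i := a.2.1 _

theorem Comp.part_coe (a : Comp n d) (i : Fin d) : a.part i = a.1 i :=
  congrArg a.1 (Fin.ext (Nat.mod_eq_of_lt i.2))

theorem Comp.part_add_self (a : Comp n d) (i : ℕ) : a.part (i + d) = a.part i :=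
  congrArg a.1 (Fin.ext (Nat.add_mod_right i d))

theorem Comp.part_rot (a : Comp n d) (i : ℕ) : (Rot n d a : Comp n d).part i = a.part (i + 1) := by
  change a.1 (finRotate d (Fin.ofNat d i)) = a.1 (Fin.ofNat d (i + 1))
  rw [finRotate_apply]
  exact congrArg a.1 (Fin.ext (by simp [Fin.val_add]))

theorem Comp.psum_succ (a : Comp n d) (k : ℕ) : a.psum (k + 1) = a.psum k + a.part k :=
  Finset.sum_range_succ _ _

theorem Comp.psum_rot (a : Comp n d) (k : ℕ) :
    a.part 0 + (Rot n d a : Comp n d).psum k = a.psum (k + 1) := by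
  rw [psum, psum, Finset.sum_range_succ', add_comm]
  simp only [part_rot]

theorem Comp.psum_strictMono (a : Comp n d) : StrictMono a.psum :=
  strictMono_nat_of_lt_succ fun k => by
    rw [psum_succ]
    exact Nat.lt_add_of_pos_right (a.part_pos k)

theorem Comp.psum_self (a : Comp n d) : a.psum d = n := by
  rw [psum, Finset.sum_range]
  simp only [part_coe]
  exact a.2.2

theorem Comp.psum_add_self (a : Comp n d) (k : ℕ) : a.psum (k + d) = a.psum k + n := by
  induction k with
  | zero => rw [zero_add, psum_self]; simp [psum]
  | succ k ih => rw [add_right_comm, psum_succ, psum_succ, ih, part_add_self]; omega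

theorem Comp.psum_lt (a : Comp n d) {k : ℕ} (hk : k < d) : a.psum k < n :=
  (a.psum_strictMono hk).trans_eq a.psum_self

theorem Comp.ext_psum {a b : Comp n d} (h : ∀ k < d, a.psum k = b.psum k) : a = b := by
  apply Subtype.ext
  funext i
  have h1 := h i i.2
  have h2 : a.psum (i + 1) = b.psum (i + 1) := by
    by_cases hi : (i : ℕ) + 1 < d
    · exact h _ hi
    · rw [show (i : ℕ) + 1 = d by omega, a.psum_self, b.psum_self]
  rw [Comp.psum_succ, Comp.psum_succ, h1, a.part_coe, b.part_coe] at h2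
  omega

theorem natCast_inj_of_lt {x y : ℕ} (hx : x < n) (hy : y < n) : (x : ZMod n) = y ↔ x = y := by
  rw [ZMod.natCast_eq_natCast_iff', Nat.mod_eq_of_lt hx, Nat.mod_eq_of_lt hy]

/-- Moving the base point of a pointed composition to the next coin. -/
def nextCoin (n d : ℕ) [NeZero d] : Equiv.Perm (Comp n d × ZMod n) where
  toFun y := (Rot n d y.1, y.2 + y.1.part 0)
  invFun y := ((Rot n d).symm y.1, y.2 - ((Rot n d).symm y.1).part 0)
  left_inv y := by simp
  right_inv y := by simp

theorem nextCoin_comm_shiftBack : Commute (nextCoin n d) (shiftBack n d) := by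
  ext1 y
  exact Prod.ext rfl (sub_add_eq_add_sub _ _ _)

theorem nextCoin_pow_apply (k : ℕ) (y : Comp n d × ZMod n) :
    ((nextCoin n d ^ k) y).2 = y.2 + y.1.psum k := by
  induction k generalizing y with
  | zero => simp [Comp.psum]
  | succ k ih =>
    rw [pow_succ, Equiv.Perm.mul_apply, ih]
    change y.2 + y.1.part 0 + ((Rot n d y.1 : Comp n d).psum k : ZMod n) = _
    rw [add_assoc, ← Nat.cast_add, Comp.psum_rot]

variable [NeZero n]

/-- The word read around the cycle `ℤ/nℤ` whose coins are `p, p + a₁, p + a₁ + a₂, …`: the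
composition `a` lists the distances between cyclically consecutive coins, from the coin `p`. -/
def gapWord (y : Comp n d × ZMod n) : Word n d :=
  ⟨(Finset.range d).image fun k => (y.2 + y.1.psum k : ZMod n).val, by
    rw [Finset.mem_powersetCard]
    constructor
    · intro x hx
      obtain ⟨k, _, rfl⟩ := Finset.mem_image.1 hx
      exact Finset.mem_range.2 (ZMod.val_lt _)
    · rw [Finset.card_image_of_injOn, Finset.card_range]
      intro k hk l hl h
      have h1 := add_left_cancel (ZMod.val_injective n h)
      rw [natCast_inj_of_lt (y.1.psum_lt (Finset.mem_range.1 hk))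
        (y.1.psum_lt (Finset.mem_range.1 hl))] at h1
      exact y.1.psum_strictMono.injective h1⟩

theorem val_mem_gapWord {y : Comp n d × ZMod n} {z : ZMod n} :
    z.val ∈ (gapWord y).1 ↔ ∃ k < d, z = y.2 + y.1.psum k := by
  simp only [gapWord, Finset.mem_image, Finset.mem_range]
  exact exists_congr fun k => and_congr_right fun _ =>
    ⟨fun h => (ZMod.val_injective n h).symm, fun h => by rw [h]⟩

theorem gapWord_injective_left {a b : Comp n d} {p : ZMod n} (h : gapWord (a, p) = gapWord (b, p)) :
    a = b := by
  have key : ∀ {a b : Comp n d}, gapWord (a, p) = gapWord (b, p) →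
      Set.range (fun k : Fin d => a.psum k) ⊆ Set.range fun k : Fin d => b.psum k := by
    rintro a b h _ ⟨k, rfl⟩
    have h1 : (p + a.psum k : ZMod n).val ∈ (gapWord (b, p)).1 := by
      rw [← h]
      exact val_mem_gapWord.2 ⟨k, k.2, rfl⟩
    obtain ⟨l, hl, h2⟩ := val_mem_gapWord.1 h1
    have h3 := add_left_cancel h2
    rw [natCast_inj_of_lt (a.psum_lt k.2) (b.psum_lt hl)] at h3
    exact ⟨⟨l, hl⟩, h3.symm⟩
  have hs : ∀ a : Comp n d, StrictMono fun k : Fin d => a.psum k :=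
    fun a _ _ hkl => a.psum_strictMono hkl
  have h1 := ((hs a).range_inj (hs b)).1 ((key h).antisymm (key h.symm))
  exact Comp.ext_psum fun k hk => congrFun h1 ⟨k, hk⟩

theorem exists_gapWord_eq (S : Word n d) {p : ZMod n} (hp : p.val ∈ S.1) :
    ∃ a : Comp n d, gapWord (a, p) = S := by
  obtain ⟨hS1, hS2⟩ := Finset.mem_powersetCard.1 S.2
  have hd : 0 < d := Nat.pos_of_ne_zero (NeZero.ne d)
  -- the distances from `p` to the coins
  set T : Finset ℕ := S.1.image fun x : ℕ => ((x : ZMod n) - p).val with hT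
  have hTcard : T.card = d := by
    rw [hT, Finset.card_image_of_injOn, hS2]
    intro x hx y hy hxy
    have h1 := sub_left_injective (ZMod.val_injective n hxy)
    exact (natCast_inj_of_lt (Finset.mem_range.1 (hS1 hx)) (Finset.mem_range.1 (hS1 hy))).1 h1
  have hTlt : ∀ t ∈ T, t < n := by
    intro t ht
    obtain ⟨x, _, rfl⟩ := Finset.mem_image.1 ht
    exact ZMod.val_lt _
  have h0T : 0 ∈ T := Finset.mem_image.2 ⟨p.val, hp, by simp⟩
  set b : ℕ → ℕ := fun k => if h : k < d then T.orderEmbOfFin hTcard ⟨k, h⟩ else n with hb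
  have hbT : ∀ k < d, b k ∈ T := fun k hk => by
    rw [hb]
    simp only [dif_pos hk]
    exact Finset.orderEmbOfFin_mem T hTcard _
  have hb0 : b 0 = 0 := by
    have h1 : b 0 = T.min' ⟨0, h0T⟩ := by
      rw [hb]
      simp only [dif_pos hd]
      exact Finset.orderEmbOfFin_zero hTcard hd
    have := Finset.min'_le T 0 h0T
    omega
  have hlt : ∀ k < d, b k < b (k + 1) := by
    intro k hk
    by_cases hk1 : k + 1 < d
    · rw [hb]
      simp only [dif_pos hk, dif_pos hk1]
      exact (T.orderEmbOfFin hTcard).strictMono (Fin.mk_lt_mk.2 k.lt_succ_self)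
    · have h1 : b (k + 1) = n := by
        rw [hb]
        simp only [dif_neg hk1]
      rw [h1]
      exact hTlt _ (hbT k hk)
  have hsum : ∀ k ≤ d, ∑ i ∈ Finset.range k, (b (i + 1) - b i) = b k := by
    intro k
    induction k with
    | zero => intro _; simp [hb0]
    | succ k ih =>
      intro hk
      rw [Finset.sum_range_succ, ih (by omega)]
      have := hlt k hk
      omega
  refine ⟨⟨fun i => b (i + 1) - b i, fun i => Nat.sub_pos_of_lt (hlt i i.2), ?_⟩, ?_⟩
  · rw [← Finset.sum_range fun i => b (i + 1) - b i, hsum d le_rfl, hb]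
    simp
  · set a : Comp n d := ⟨fun i => b (i + 1) - b i, _⟩ with ha
    have hpsum : ∀ k < d, a.psum k = b k := by
      intro k hk
      rw [← hsum k hk.le, Comp.psum]
      refine Finset.sum_congr rfl fun i hi => ?_
      have hi' : i < d := (Finset.mem_range.1 hi).trans hk
      exact a.part_coe ⟨i, hi'⟩
    apply Subtype.ext
    refine Finset.eq_of_subset_of_card_le ?_ ?_
    · intro x hx
      obtain ⟨k, hk, rfl⟩ := Finset.mem_image.1 hx
      have hk' := Finset.mem_range.1 hk
      obtain ⟨x, hx, hxb⟩ := Finset.mem_image.1 (hbT k hk')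
      simp only [hpsum k hk']
      rw [← hxb, ZMod.natCast_val, ZMod.cast_id, add_sub_cancel,
        ZMod.val_natCast_of_lt (Finset.mem_range.1 (hS1 hx))]
      exact hx
    · rw [hS2, (Finset.mem_powersetCard.1 (gapWord (a, p)).2).2]

/-- Each word comes from exactly `d` pointed compositions, one for each of its coins. -/
theorem ncard_gapWord_fiber (S : Word n d) : {y | gapWord y = S}.ncard = d := by
  obtain ⟨hS1, hS2⟩ := Finset.mem_powersetCard.1 S.2
  have hinj : Set.InjOn Prod.snd {y | gapWord y = S} := by
    rintro ⟨a, p⟩ h1 ⟨b, p'⟩ h2 (rfl : p = p')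
    rw [gapWord_injective_left (Eq.trans h1 (Eq.symm h2))]
  have himg : Prod.snd '' {y | gapWord y = S} = ZMod.val ⁻¹' (S.1 : Set ℕ) := by
    ext p
    constructor
    · rintro ⟨⟨a, p⟩, rfl, rfl⟩
      exact val_mem_gapWord.2 ⟨0, Nat.pos_of_ne_zero (NeZero.ne d), by simp [Comp.psum]⟩
    · intro hp
      obtain ⟨a, ha⟩ := exists_gapWord_eq S hp
      exact ⟨(a, p), ha, rfl⟩
  rw [← hinj.ncard_image, himg,
    Set.ncard_preimage_of_injective_subset_range (ZMod.val_injective n), Set.ncard_coe_finset, hS2]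
  intro x hx
  exact ⟨x, ZMod.val_natCast_of_lt (Finset.mem_range.1 (hS1 hx))⟩

theorem gapWord_surjective : Function.Surjective (gapWord : Comp n d × ZMod n → Word n d) := by
  intro S
  have h : {y | gapWord y = S}.Nonempty := by
    apply Set.nonempty_of_ncard_ne_zero
    rw [ncard_gapWord_fiber]
    exact NeZero.ne d
  exact h

theorem gapWord_nextCoin (y : Comp n d × ZMod n) : gapWord (nextCoin n d y) = gapWord y := by
  apply Subtype.ext
  refine Finset.eq_of_subset_of_card_le ?_ ?_
  · intro x hx
    obtain ⟨k, hk, rfl⟩ := Finset.mem_image.1 hx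
    have hk' := Finset.mem_range.1 hk
    rw [val_mem_gapWord]
    change ∃ l < d, y.2 + y.1.part 0 + ((Rot n d y.1 : Comp n d).psum k : ZMod n) = _
    rw [add_assoc, ← Nat.cast_add, Comp.psum_rot]
    by_cases hk1 : k + 1 < d
    · exact ⟨k + 1, hk1, rfl⟩
    · refine ⟨0, by omega, ?_⟩
      rw [show k + 1 = 0 + d by omega, Comp.psum_add_self, Nat.cast_add, ZMod.natCast_self,
        add_zero]
  · rw [(Finset.mem_powersetCard.1 (gapWord y).2).2,
      (Finset.mem_powersetCard.1 (gapWord (nextCoin n d y)).2).2]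

theorem gapWord_eq_iff (y y' : Comp n d × ZMod n) :
    gapWord y = gapWord y' ↔ (nextCoin n d).SameCycle y y' := by
  have hinv : ∀ (i : ℤ) y, gapWord ((nextCoin n d ^ i) y) = gapWord y := fun i y => by
    have := zpow_apply_of_semiconj (f := (1 : Equiv.Perm (Word n d))) gapWord_nextCoin i y
    rwa [one_zpow] at this
  constructor
  · intro h
    have h1 : y'.2.val ∈ (gapWord y).1 := by
      rw [h]
      exact val_mem_gapWord.2 ⟨0, Nat.pos_of_ne_zero (NeZero.ne d), by simp [Comp.psum]⟩
    obtain ⟨k, _, hk⟩ := val_mem_gapWord.1 h1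
    refine ⟨k, ?_⟩
    have h2 : ((nextCoin n d ^ (k : ℤ)) y).2 = y'.2 := by
      rw [zpow_natCast, nextCoin_pow_apply, hk]
    refine Prod.ext (gapWord_injective_left (p := y'.2) ?_) h2
    have h3 := hinv k y
    rw [h] at h3
    rwa [← Prod.eta ((nextCoin n d ^ (k : ℤ)) y), h2] at h3
  · rintro ⟨i, rfl⟩
    exact (hinv i y).symm

theorem gapWord_shiftBack (y : Comp n d × ZMod n) :
    gapWord (shiftBack n d y) = wordRot n d (gapWord y) := by
  have hn : 0 < n := Nat.pos_of_ne_zero (NeZero.ne n)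
  have hval : ∀ z : ZMod n, (z - 1).val = if z.val = 0 then n - 1 else z.val - 1 := by
    intro z
    have hz := ZMod.val_lt z
    have h1 : z - 1 = ((if z.val = 0 then n - 1 else z.val - 1 : ℕ) : ZMod n) := by
      split_ifs with h
      · rw [Nat.cast_sub (by omega), ZMod.natCast_self, (ZMod.val_eq_zero z).1 h, Nat.cast_one]
      · rw [Nat.cast_sub (by omega), ZMod.natCast_val, ZMod.cast_id, Nat.cast_one]
    rw [h1, ZMod.val_natCast_of_lt]
    split_ifs <;> omega
  apply Subtype.ext
  rw [coe_wordRot hn, gapWord, gapWord, Finset.image_image]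
  refine Finset.image_congr fun k _ => ?_
  simp only [Function.comp_apply]
  rw [← hval]
  exact congrArg ZMod.val (sub_add_eq_add_sub _ _ _)

/-- The orbits of words under rotation correspond to the orbits of compositions under rotation. -/
theorem exists_equiv_orb_wordRot_rot (n d : ℕ) [NeZero n] [NeZero d] :
    ∃ e : Orb (wordRot n d) ≃ Orb (Rot n d), ∀ O : Orb (wordRot n d),
      n * (e O : Set (Comp n d)).ncard = d * (O : Set (Word n d)).ncard :=
  have := finite_comp n d
  exists_equiv_orb nextCoin_comm_shiftBack gapWord_surjective (r := Prod.fst) Prod.fst_surjective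
    gapWord_shiftBack (fun _ => rfl) gapWord_eq_iff fst_eq_iff ncard_gapWord_fiber ncard_fst_fiber

end Composition

end PermutoricPromotion

theorem proposition6p3 (n d : ℕ) (hd : 1 ≤ d) (hdn : d < n) :
    ∃ Ω : PermutoricPromotion.Orb (PermutoricPromotion.Phi n d) →
        PermutoricPromotion.Orb (PermutoricPromotion.Rot n d),
      (∀ O : PermutoricPromotion.Orb (PermutoricPromotion.Phi n d),
        ((Ω O : Set (PermutoricPromotion.Comp n d)).ncard : ℚ) =
          (d : ℚ) / (n : ℚ) * ((O : Set (PermutoricPromotion.Labeling (Fin n) n)).ncard : ℚ)) ∧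
      (∀ O' : PermutoricPromotion.Orb (PermutoricPromotion.Rot n d),
        (Ω ⁻¹' {O'}).ncard = d ! * (n - d)!) := by
  obtain ⟨m, rfl⟩ := Nat.exists_eq_add_of_le hdn.le
  have : NeZero d := ⟨by omega⟩
  have : NeZero (d + m) := ⟨by omega⟩
  obtain ⟨E, hE⟩ := PermutoricPromotion.exists_equiv_phi d m
  obtain ⟨e₁, he₁⟩ := PermutoricPromotion.exists_equiv_orb_prod E hE
  obtain ⟨e₂, he₂⟩ := PermutoricPromotion.exists_equiv_orb_wordRot_rot (d + m) d
  refine ⟨fun O => e₂ (e₁.symm O).2, fun O => ?_, fun O' => ?_⟩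
  · obtain ⟨⟨k, O₁⟩, rfl⟩ := e₁.surjective O
    simp only [Equiv.symm_apply_apply]
    rw [he₁, div_mul_eq_mul_div, eq_div_iff (NeZero.ne _), mul_comm]
    exact_mod_cast he₂ O₁
  · have h : (fun O => e₂ (e₁.symm O).2) ⁻¹' {O'} =
        Set.range fun k => e₁ (k, e₂.symm O') := by
      ext O
      obtain ⟨⟨k, O₁⟩, rfl⟩ := e₁.surjective O
      simp only [Set.mem_preimage, Set.mem_singleton_iff, Equiv.symm_apply_apply, Set.mem_range,
        EmbeddingLike.apply_eq_iff_eq, Prod.mk.injEq, exists_eq_left]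
      rw [Equiv.symm_apply_eq, eq_comm]
    have hinj : Function.Injective fun k => e₁ (k, e₂.symm O') :=
      e₁.injective.comp (Prod.mk_left_injective _)
    rw [h, ← Set.image_univ, Set.ncard_image_of_injective _ hinj, Set.ncard_univ, Nat.card_prod,
      Nat.card_perm, Nat.card_perm, Nat.card_fin, Nat.card_fin, Nat.add_sub_cancel_left]
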